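/- Let $n,p\ge 1$, $\varepsilon_0>0$, $\sigma_n\in(0,1]$. Let $X_1,\dots,X_n$ be i.i.d. $\mathrm N(0,\Sigma)$ in $\mathbb R^p$ and $Y=\frac1n\sum_{l=1}^n X_lX_l^T$, regarded as an element of $\mathbb R^{p^2}$ with the Euclidean (Frobenius) norm $\|\cdot\|$; $\mathbb P_\Sigma,\mathbb E_\Sigma$ refer to the law of $Y$. Let $\mathcal C_{\varepsilon_0}$ be the set of $p\times p$ covariance matrices with all eigenvalues in $[\varepsilon_0,\varepsilon_0^{-1}]$. For $I\in\mathcal I=\{0,1,\dots,p\}$ let $\mathbb L_I\subseteq\mathbb R^{p^2}$ be the space of symmetric matrices $x$ with $x_{ij}=0$ whenever $|i-j|>I$, $\mathrm P_I$ the orthogonal projection onto $\mathbb L_I$, $\rho(I)=\dim\mathbb L_I=p+I\big(p-\frac{I+1}2\big)$, $r^2(I,\Sigma)=\|\Sigma-\mathrm P_I\Sigma\|^2+\sigma_n^2\rho(I)$, and $r^2(\Sigma)=\min_{I\in\mathcal I} r^2(I,\Sigma)$ (oracle rate). Put $\alpha=\min\{1,5\varepsilon_0^2/4\}$ and fix $\nu>0$,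 $\varkappa>\frac{32\nu+10+\alpha}{4\alpha}$, $\delta\in(0,1)$ and $\tau_0>\frac{1+\delta}{1-\delta}\cdot\frac{3(1+\varkappa\alpha)}{\alpha}$. Let $$\tilde\pi(I|Y)=\frac{e^{-\varkappa\rho(I)}e^{-\|Y-\mathrm P_IY\|^2/(2\sigma_n^2)}}{\sum_{J\in\mathcal I}e^{-\varkappa\rho(J)}e^{-\|Y-\mathrm P_JY\|^2/(2\sigma_n^2)}},$$ let $\hat I=\hat I(Y)$ be any measurable choice of a minimiser over $I\in\mathcal I$ of $\|Y-\mathrm P_IY\|^2+2\varkappa\sigma_n^2\rho(I)$, and let $\check\pi(I|Y)=1\{I=\hat I\}$. Let $\hat\pi(I|Y)$ be either $\tilde\pi(I|Y)$ or $\check\pi(I|Y)$. Let $\mathbb P_Z$ be any probability measure on $\mathbb R^{p^2}$ with $\mathbb E_Z Z=0$ and $\mathbb E_Z e^{\alpha\|\mathrm P_IZ\|^2}\le e^{\rho(I)}$ for all $I\in\mathcal I$. Define the data dependent measure $\hat\pi(\vartheta\in B|Y)=\sum_{I}\hat\pi(I|Y)\,\mathbb P_Z(\mathrm P_Iy+\sigma_n\mathrm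 P_IZ\in B)\big|_{y=Y}$, its mean $\hat\Sigma=\sum_I\hat\pi(I|Y)\mathrm P_IY$, and $\hat r^2=\sigma_n^2+\sigma_n^2\rho(\hat I)$. For $t\ge0$ let $\Theta_{\rm eb}(t)$ be the set of $\Sigma$ such that $\|\Sigma-\mathrm P_{I_*}\Sigma\|^2\le t\sigma_n^2(1+\rho(I_*))$ for some minimiser $I_*$ over $I\in\mathcal I$ of $\|\Sigma-\mathrm P_I\Sigma\|^2+\tau_0\sigma_n^2\rho(I)$. Define the constants $H'=4$, $\bar c_1=\frac{3\varepsilon_0^4}{320}$, $\bar c_2=2$, $C_\nu=\frac{e^\nu}{e^\nu-1}$, $c_2=\frac{\alpha}{16}$, $c_3=\frac6\alpha+4\varkappa$; $M_0=\frac{c_3(2\nu+2\alpha+4)}{\alpha}$, $H_0=1+2C_\nu$, $m_0=\min\{\frac\alpha8,\frac{c_2\alpha}{4(2\nu+2\alpha+4)},\frac\alpha4\}$; $M_1=\frac{12c_3(\nu+1)}{\alpha}$, $C_3=\frac{\alpha}{12(\nu+1)}$, $m_1=\min\{\frac{\alpha}{14},\frac{c_2C_3}{4}\}$, $H_1=\max\big\{C_\nu\big[3(\tfrac{2c_3}{M_1}+C_3)+\tfrac6\alpha+\tfrac{6}{c_2e}+\tfrac{3}{\alpha\min\{1/2,c_2/4\}}\big],e^{m_1}\big\}$;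 $M_2=\frac{M_1}{\delta}$, $H_2=H_1+C_\nu$, $m_2=\min\{m_1,\frac{\tau_0\alpha}{3M_2}\}$; $M_3=c_3$, $H_3=C_\nu$, $m_3=c_2$. Let $\Delta=H'e^{-\bar c_1n\sigma_n^2+\bar c_2\log p}$ and $\hat R_M^2=(t+1)M_2\hat r^2+(t+2)M\sigma_n^2$, and let $B(c,R)$ be the closed ball. Then for all $M,t\ge0$, $$\sup_{\Sigma\in\mathcal C_{\varepsilon_0}}\mathbb E_\Sigma\hat\pi\big(\|\vartheta-\Sigma\|^2\ge M_0r^2(\Sigma)+M\sigma_n^2\,\big|\,Y\big)\le\Delta+H_0e^{-m_0M},$$ $$\sup_{\Sigma\in\mathcal C_{\varepsilon_0}}\mathbb P_\Sigma\big(\|\hat\Sigma-\Sigma\|^2\ge M_1r^2(\Sigma)+M\sigma_n^2\big)\le\Delta+H_1e^{-m_1M},$$ $$\sup_{\Sigma\in\mathcal C_{\varepsilon_0}}\mathbb E_\Sigma\hat\pi\big(I: r^2(I,\Sigma)\ge c_3r^2(\Sigma)+M\sigma_n^2\,\big|\,Y\big)\le\Delta+C_\nu e^{-c_2M},$$ $$\sup_{\Sigma\in\mathcal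 C_{\varepsilon_0}}\mathbb P_\Sigma\big(\hat r^2\ge M_3r^2(\Sigma)+(M+1)\sigma_n^2\big)\le\Delta+H_3e^{-m_3M},$$ $$\sup_{\Sigma\in\mathcal C_{\varepsilon_0}\cap\Theta_{\rm eb}(t)}\mathbb P_\Sigma\big(\Sigma\notin B(\hat\Sigma,\hat R_M)\big)\le\Delta+H_2e^{-m_2M}.$$ -/

import Mathlib

open MeasureTheory ProbabilityTheory
open scoped ENNReal

namespace BandedCov

/-! ### The parameter and the data -/

/-- `ℝ^{p²}`: vectorised `p × p` matrices with the Euclidean (i.e. Frobenius) norm. -/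
abbrev Vec (p : ℕ) : Type := EuclideanSpace ℝ (Fin p × Fin p)

/-- `vec(A)`. -/
def vec {p : ℕ} (A : Matrix (Fin p) (Fin p) ℝ) : Vec p :=
  WithLp.toLp 2 fun ij => A ij.1 ij.2

/-- `𝒞_{ε₀}`: the covariance (i.e. positive semidefinite) matrices all of whose eigenvalues lie
in `[ε₀, ε₀⁻¹]`. -/
def covClass (p : ℕ) (ε₀ : ℝ) : Set (Matrix (Fin p) (Fin p) ℝ) :=
  {S | ∃ h : S.PosSemidef, ∀ i, ε₀ ≤ h.isHermitian.eigenvalues i ∧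
    h.isHermitian.eigenvalues i ≤ ε₀⁻¹}

/-- The law of the sample `X₁, …, Xₙ`, independent with `X_l ∼ N(0, S)`. -/
noncomputable def sampleLaw (n p : ℕ) (S : Matrix (Fin p) (Fin p) ℝ) :
    Measure (Fin n → EuclideanSpace ℝ (Fin p)) :=
  Measure.pi fun _ : Fin n => multivariateGaussian 0 S

/-- The statistic `Y = vec (n⁻¹ ∑_l X_l X_lᵀ)`. -/
noncomputable def secondMoment {n p : ℕ} (X : Fin n → EuclideanSpace ℝ (Fin p)) : Vec p :=
  vec (Matrix.of fun i j => (n : ℝ)⁻¹ * ∑ l, X l i * X l j)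

theorem measurable_secondMoment (n p : ℕ) :
    Measurable (secondMoment : (Fin n → EuclideanSpace ℝ (Fin p)) → Vec p) := by
  refine (WithLp.measurable_toLp 2 (Fin p × Fin p → ℝ)).comp ?_
  refine measurable_pi_lambda _ fun ij => ?_
  simp only [Matrix.of_apply]
  fun_prop

/-- `ℙ_Σ`: the law of `Y`. -/
noncomputable def lawY (n p : ℕ) (S : Matrix (Fin p) (Fin p) ℝ) : Measure (Vec p) :=
  (sampleLaw n p S).map secondMoment

/-! ### Banding structures, the complexity majorant and the oracle rate -/

/-- `𝕃_I`: (vectorised) symmetric matrices with `x_{ij} = 0` whenever `|i - j| > I`. -/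
def bandSpace (p I : ℕ) : Submodule ℝ (Vec p) where
  carrier := {x | (∀ i j : Fin p, x (i, j) = x (j, i)) ∧
    ∀ i j : Fin p, (I : ℤ) < |(i : ℤ) - (j : ℤ)| → x (i, j) = 0}
  zero_mem' := by simp
  add_mem' := by
    rintro x y ⟨hx, hx'⟩ ⟨hy, hy'⟩
    refine ⟨fun i j => ?_, fun i j h => ?_⟩
    · simp [hx i j, hy i j]
    · simp [hx' i j h, hy' i j h]
  smul_mem' := by
    rintro c x ⟨hx, hx'⟩
    refine ⟨fun i j => ?_, fun i j h => ?_⟩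
    · simp [hx i j]
    · simp [hx' i j h]

/-- `P_I`: the orthogonal projection of `ℝ^{p²}` onto `𝕃_I`. -/
noncomputable def proj (p I : ℕ) : Vec p →L[ℝ] Vec p := (bandSpace p I).starProjection

/-- The majorant `ρ(I) = d_I = dim 𝕃_I = p + I (p - (I+1)/2)`, used for `0 ≤ I ≤ p`. -/
noncomputable def rho (p I : ℕ) : ℝ := p + I * (p - ((I : ℝ) + 1) / 2)

/-- `‖θ - P_I θ‖² + s ρ(I)`; the local rate `r²(I, θ)` is the case `s = σ²`. -/
noncomputable def localRate (p : ℕ) (s : ℝ) (I : ℕ) (θ : Vec p) : ℝ :=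
  ‖θ - proj p I θ‖ ^ 2 + s * rho p I

/-- The oracle rate `r²(θ) = min_{0 ≤ I ≤ p} r²(I, θ)`. -/
noncomputable def oracleRate (p : ℕ) (s : ℝ) (θ : Vec p) : ℝ :=
  ⨅ I : Fin (p + 1), localRate p s I θ

/-- The EBR class `Θ_eb(t)`: parameters with `‖θ - P_{I_*} θ‖² ≤ t σ² (1 + ρ(I_*))`, where `I_*`
is a `τ₀`-oracle, i.e. a minimiser of `‖θ - P_I θ‖² + τ₀ σ² ρ(I)`. A parameter belongs to the class
as soon as one of its `τ₀`-oracles satisfies the bound, so that the class contains the one obtained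
from any rule for breaking ties. -/
def ebrClass (p : ℕ) (σ τ₀ t : ℝ) : Set (Vec p) :=
  {θ | ∃ I : Fin (p + 1),
    (∀ J : Fin (p + 1), localRate p (τ₀ * σ ^ 2) I θ ≤ localRate p (τ₀ * σ ^ 2) J θ) ∧
    ‖θ - proj p I θ‖ ^ 2 ≤ t * σ ^ 2 * (1 + rho p I)}

/-! ### Data dependent measures, estimators and the confidence radius -/

/-- `λ_I exp(-‖y - P_I y‖² / (2σ²))` with `λ_I = exp(-ϰ ρ(I))`. -/
noncomputable def rawWeight (p : ℕ) (σ κ : ℝ) (y : Vec p) (I : ℕ) : ℝ :=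
  Real.exp (-κ * rho p I) * Real.exp (-(1 / (2 * σ ^ 2)) * ‖y - proj p I y‖ ^ 2)

/-- `Ihat` is a structure selector: a measurable choice of a minimiser over `0 ≤ I ≤ p` of
`‖y - P_I y‖² + σ² · 2ϰρ(I)`. -/
def IsSelector (p : ℕ) (σ κ : ℝ) (Ihat : Vec p → Fin (p + 1)) : Prop :=
  Measurable Ihat ∧ ∀ (y : Vec p) (J : Fin (p + 1)),
    ‖y - proj p (Ihat y) y‖ ^ 2 + σ ^ 2 * (2 * κ * rho p (Ihat y)) ≤
      ‖y - proj p J y‖ ^ 2 + σ ^ 2 * (2 * κ * rho p J)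

/-- The two procedures: model averaging (MA) and model selection (MS). -/
inductive Procedure
  | averaging
  | selection

/-- `π̂(I | y)`: the normalised weights for MA, the point mass at `Î(y)` for MS. -/
noncomputable def weight (p : ℕ) (σ κ : ℝ) (Ihat : Vec p → Fin (p + 1)) (y : Vec p)
    (I : Fin (p + 1)) : Procedure → ℝ
  | .averaging => rawWeight p σ κ y I / ∑ J : Fin (p + 1), rawWeight p σ κ y J
  | .selection => if I = Ihat y then 1 else 0

open Classical in
/-- `π̂(I ∈ G | y)`. -/
noncomputable def structProb (p : ℕ) (σ κ : ℝ) (Ihat : Vec p → Fin (p + 1)) (k : Procedure)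
    (y : Vec p) (G : Set (Fin (p + 1))) : ℝ :=
  ∑ I : Fin (p + 1), if I ∈ G then weight p σ κ Ihat y I k else 0

/-- The law `ℙ_Z` used in the data dependent measures: a centred probability measure on `ℝ^{p²}`
with `𝔼_Z exp(α ‖P_I Z‖²) ≤ exp(d_I)` for all structures `I`. -/
structure IsNoiseLaw (p : ℕ) (α : ℝ) (PZ : Measure (Vec p)) : Prop where
  isProb : IsProbabilityMeasure PZ
  centred : ∀ ij : Fin p × Fin p, Integrable (fun z : Vec p => z ij) PZ ∧ ∫ z, z ij ∂PZ = 0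
  expMoment : ∀ I : Fin (p + 1),
    ∫⁻ z, ENNReal.ofReal (Real.exp (α * ‖proj p I z‖ ^ 2)) ∂PZ ≤
      ENNReal.ofReal (Real.exp (rho p I))

/-- `π̂(· | y)`: the mixture over `I`, with weights `π̂(I | y)`, of the laws of
`P_I y + σ P_I Z`, `Z ∼ ℙ_Z`. -/
noncomputable def ddm (p : ℕ) (σ κ : ℝ) (Ihat : Vec p → Fin (p + 1)) (PZ : Measure (Vec p))
    (k : Procedure) (y : Vec p) : Measure (Vec p) :=
  ∑ I : Fin (p + 1), ENNReal.ofReal (weight p σ κ Ihat y I k) •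
    PZ.map fun z => proj p I y + σ • proj p I z

/-- The mean `∑_I π̂(I | y) P_I y` of `π̂(· | y)`; it is `P_{Î} y` for MS. -/
noncomputable def estimator (p : ℕ) (σ κ : ℝ) (Ihat : Vec p → Fin (p + 1)) (k : Procedure)
    (y : Vec p) : Vec p :=
  ∑ I : Fin (p + 1), weight p σ κ Ihat y I k • proj p I y

/-- `r̂² = σ² + σ² ρ(Î)`. -/
noncomputable def rhatSq (p : ℕ) (σ : ℝ) (Ihat : Vec p → Fin (p + 1)) (y : Vec p) : ℝ :=
  σ ^ 2 + σ ^ 2 * rho p (Ihat y)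

/-! ### Constants

They depend only on `α` (a function of `ε₀`), `ν`, `ϰ` and, for `M₂`, `m₂`, on `δ` and `τ₀`. -/

/-- `α = 1 ∧ 5ε₀²/4`. -/
noncomputable def alphaC (ε₀ : ℝ) : ℝ := min 1 (5 * ε₀ ^ 2 / 4)

/-- The lower bound for `ϰ`. -/
noncomputable def kappaBar (α ν : ℝ) : ℝ := (32 * ν + 10 + α) / (4 * α)

/-- `τ̄ = 3 (1 + ϰα) / α`. -/
noncomputable def tauBar (α κ : ℝ) : ℝ := 3 * (1 + κ * α) / α

/-- `C_ν`, a bound for `∑_I exp(-ν ρ(I))`. -/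
noncomputable def Cnu (ν : ℝ) : ℝ := Real.exp ν / (Real.exp ν - 1)

noncomputable def c₂ (α : ℝ) : ℝ := α / 16
noncomputable def c₃ (α κ : ℝ) : ℝ := 6 / α + 4 * κ

noncomputable def M₀ (α ν κ : ℝ) : ℝ := c₃ α κ * (2 * ν + 2 * α + 4) / α
noncomputable def H₀ (ν : ℝ) : ℝ := 1 + 2 * Cnu ν
noncomputable def m₀ (α ν : ℝ) : ℝ :=
  min (α / 8) (min (c₂ α * (α / (4 * (2 * ν + 2 * α + 4)))) (α / 4))

noncomputable def M₁ (α ν κ : ℝ) : ℝ := 12 * c₃ α κ * (ν + 1) / α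
noncomputable def C₃ (α ν : ℝ) : ℝ := α / (12 * (ν + 1))
noncomputable def m₁ (α ν : ℝ) : ℝ := min (α / 14) (c₂ α * C₃ α ν / 4)
noncomputable def H₁ (α ν κ : ℝ) : ℝ :=
  max (Cnu ν * (3 * (2 * c₃ α κ / M₁ α ν κ + C₃ α ν) + 6 / α + 6 / (c₂ α * Real.exp 1)
      + 3 / (α * min (1 / 2) (c₂ α / 4))))
    (Real.exp (m₁ α ν))

noncomputable def M₂ (α ν κ δ : ℝ) : ℝ := M₁ α ν κ / δ
noncomputable def H₂ (α ν κ : ℝ) : ℝ := H₁ α ν κ + Cnu ν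
noncomputable def m₂ (α ν κ δ τ₀ : ℝ) : ℝ := min (m₁ α ν) (τ₀ * α / 3 / M₂ α ν κ δ)

noncomputable def M₃ (α κ : ℝ) : ℝ := c₃ α κ
noncomputable def H₃ (ν : ℝ) : ℝ := Cnu ν
noncomputable def m₃ (α : ℝ) : ℝ := c₂ α

/-- `H' exp(-c̄₁ n σ² + c̄₂ log p)` with `H' = 4`, `c̄₁ = 3ε₀⁴/320`, `c̄₂ = 2`. -/
noncomputable def remainder (ε₀ : ℝ) (n p : ℕ) (σ : ℝ) : ℝ :=
  4 * Real.exp (-(3 * ε₀ ^ 4 / 320) * n * σ ^ 2 + 2 * Real.log p)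

/-- The radius `R̂_M`, with `R̂_M² = (t+1) M₂ r̂² + (t+2) M σ²`. -/
noncomputable def radius (p : ℕ) (σ : ℝ) (Ihat : Vec p → Fin (p + 1)) (M₂ t M : ℝ)
    (y : Vec p) : ℝ :=
  Real.sqrt ((t + 1) * M₂ * rhatSq p σ Ihat y + (t + 2) * M * σ ^ 2)

end BandedCov

namespace BandedCov

/-! ### Gaussian quadratic deviations -/

/-! All randomness of `Y` is confined to one event: every entry of `Y` lies within `σ / √(4α)` of
the corresponding entry of `Σ`. Chernoff bounds for Gaussian quadratic forms, polarisation for the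
off-diagonal entries and a union bound over the `p²` entries show that its complement has
probability at most the remainder term (`lawY_goodSet_compl_le_remainder`). On it, counting the
entries in a band gives `‖P_I (Y - Σ)‖² ≤ σ² ρ(I) / α` for all `I` simultaneously
(`norm_proj_noise_le`), and the rest of the argument is deterministic in `Y`.

The central estimate is `crit_add_le`. If the local rate of `I` exceeds `c₃` times that of a
reference `J` by `M σ²`, then the penalised criterion of `I` exceeds that of `J` by `2σ² (ρ(I) + c₂
M)`. Hence averaging gives `I` weight at most `exp (-ρ(I) - c₂ M)`, and selection never picks it.
Since `∑ exp (-ρ(I)) ≤ 1`, the bad structures carry mass at most `exp (-c₂ M)`.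

Concentration of the measure follows by adding Markov's inequality for `exp (α ‖P_I Z‖²)` on the
remaining structures. The estimator bound follows by convexity of the squared norm. For the radius,
`mul_rho_le_rho_Ihat` shows that the selected dimension is at least `δ` times that of a `τ₀`-oracle.
On the good event the bad events for the estimator, the radius size and the coverage are empty, so
there the remainder alone already bounds the probability. -/

theorem one_le_one_sub_mul_exp {y : ℝ} (h : |y| ≤ 1 / 2) :
    1 ≤ (1 - y) * Real.exp (y + y ^ 2) := by
  obtain ⟨h1, h2⟩ := abs_le.1 h
  rcases le_total 0 y with hy | hy
  · have h3 := Real.quadratic_le_exp_of_nonneg (x := y + y ^ 2) (by positivity)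
    have h4 : (1 - y) * (1 + (y + y ^ 2) + (y + y ^ 2) ^ 2 / 2) ≤
        (1 - y) * Real.exp (y + y ^ 2) := mul_le_mul_of_nonneg_left h3 (by linarith)
    have h5 : (1 - y) * (1 + (y + y ^ 2) + (y + y ^ 2) ^ 2 / 2) - 1 =
        y ^ 2 / 2 * (1 - y - y ^ 2 - y ^ 3) := by ring
    have h6 : 0 ≤ 1 - y - y ^ 2 - y ^ 3 := by
      have : y ^ 2 ≤ 1 / 4 := by nlinarith
      nlinarith
    have : 0 ≤ y ^ 2 / 2 * (1 - y - y ^ 2 - y ^ 3) := by positivity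
    linarith
  · have h3 := Real.add_one_le_exp (y + y ^ 2)
    have h4 : (1 - y) * (y + y ^ 2 + 1) ≤ (1 - y) * Real.exp (y + y ^ 2) :=
      mul_le_mul_of_nonneg_left h3 (by linarith)
    have h5 : (1 - y) * (y + y ^ 2 + 1) = 1 + (-y) * y ^ 2 := by ring
    have : 0 ≤ (-y) * y ^ 2 := mul_nonneg (by linarith) (sq_nonneg y)
    linarith

theorem gaussianPDFReal_smul_exp (l x : ℝ) :
    gaussianPDFReal 0 1 x • Real.exp (l * (x ^ 2 - 1)) =
      (√(2 * Real.pi))⁻¹ * Real.exp (-l) * Real.exp (-(1 / 2 - l) * x ^ 2) := by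
  simp only [gaussianPDFReal, NNReal.coe_one, mul_one, sub_zero, smul_eq_mul]
  rw [mul_assoc, mul_assoc, ← Real.exp_add, ← Real.exp_add]
  ring_nf

theorem integrable_exp_sq_gaussianReal {l : ℝ} (hl : |l| ≤ 1 / 4) :
    Integrable (fun x => Real.exp (l * (x ^ 2 - 1))) (gaussianReal 0 1) := by
  obtain ⟨h1, h2⟩ := abs_le.1 hl
  rw [gaussianReal_of_var_ne_zero _ one_ne_zero,
    integrable_withDensity_iff_integrable_smul' (measurable_gaussianPDF _ _)
      (ae_of_all _ fun _ => gaussianPDF_lt_top)]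
  simp only [toReal_gaussianPDF, gaussianPDFReal_smul_exp]
  exact (integrable_exp_neg_mul_sq (by linarith)).const_mul _

theorem integral_exp_sq_gaussianReal_le {l : ℝ} (hl : |l| ≤ 1 / 4) :
    ∫ x, Real.exp (l * (x ^ 2 - 1)) ∂gaussianReal 0 1 ≤ Real.exp (2 * l ^ 2) := by
  obtain ⟨h1, h2⟩ := abs_le.1 hl
  rw [integral_gaussianReal_eq_integral_smul one_ne_zero]
  simp only [gaussianPDFReal_smul_exp]
  rw [integral_const_mul, integral_gaussian]
  have hpos : 0 < 1 - 2 * l := by linarith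
  have e1 : Real.pi / (1 / 2 - l) = (2 * Real.pi) * (1 - 2 * l)⁻¹ := by
    have : 1 / 2 - l ≠ 0 := by linarith
    field_simp
  rw [e1, Real.sqrt_mul (x := 2 * Real.pi) (by positivity)]
  have hne : √(2 * Real.pi) ≠ 0 := by positivity
  rw [show (√(2 * Real.pi))⁻¹ * Real.exp (-l) * (√(2 * Real.pi) * √((1 - 2 * l)⁻¹)) =
    Real.exp (-l) * √((1 - 2 * l)⁻¹) by field_simp]
  refine abs_le_of_sq_le_sq' ?_ (Real.exp_pos _).le |>.2
  rw [mul_pow, Real.sq_sqrt (by positivity), ← div_eq_mul_inv, div_le_iff₀ hpos,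
    ← Real.exp_nat_mul, ← Real.exp_nat_mul]
  -- The exact moment is `exp (-l) (1 - 2l)^(-1/2)`. After squaring, the claim is `-log (1 - 2l) ≤
  -- 2l + 4l²`, the elementary inequality at `y = 2l`.
  have h := one_le_one_sub_mul_exp (y := 2 * l) (by rw [abs_mul]; norm_num; linarith)
  have h' := mul_le_mul_of_nonneg_right h (Real.exp_pos (-(2 * l))).le
  rw [one_mul, mul_assoc, ← Real.exp_add] at h'
  calc Real.exp (((2 : ℕ) : ℝ) * -l) = Real.exp (-(2 * l)) := by push_cast; ring_nf
    _ ≤ _ := h'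
    _ = _ := by rw [mul_comm]; push_cast; ring_nf

/-- Independence turns the exponential moment of the sum into an `n`-th power. The Chernoff
parameter is absorbed into `g`, so Markov's inequality is used with parameter one. -/
theorem pi_chernoff {E : Type*} [MeasurableSpace E] (μ : Measure E) [IsProbabilityMeasure μ]
    {g : E → ℝ} {K : ℝ} (hi : Integrable (fun x => Real.exp (g x)) μ)
    (hK : ∫ x, Real.exp (g x) ∂μ ≤ Real.exp K) (n : ℕ) (s : ℝ) :
    (Measure.pi fun _ : Fin n => μ).real {X | n * s ≤ ∑ l, g (X l)} ≤ Real.exp (n * (K - s)) := by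
  have hint : Integrable (fun X : Fin n → E => Real.exp (∑ l, g (X l)))
      (Measure.pi fun _ : Fin n => μ) := by
    simp only [Real.exp_sum]
    exact Integrable.fintype_prod (f := fun _ x => Real.exp (g x)) fun _ => hi
  have hval : ∫ X : Fin n → E, Real.exp (∑ l, g (X l)) ∂(Measure.pi fun _ : Fin n => μ) ≤
      Real.exp (n * K) := by
    simp only [Real.exp_sum]
    rw [integral_fintype_prod_eq_prod (f := fun _ x => Real.exp (g x)), Finset.prod_const,
      Finset.card_univ, Fintype.card_fin, Real.exp_nat_mul]
    exact pow_le_pow_left₀ (integral_nonneg fun _ => (Real.exp_pos _).le) hK n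
  have h := measure_ge_le_exp_mul_mgf (μ := Measure.pi fun _ : Fin n => μ)
    (X := fun X => ∑ l, g (X l)) (n * s) zero_le_one (by simpa using hint)
  refine h.trans ?_
  simp only [mgf, one_mul]
  calc _ ≤ Real.exp (-1 * (n * s)) * Real.exp (n * K) :=
        mul_le_mul_of_nonneg_left hval (Real.exp_pos _).le
    _ = _ := by rw [← Real.exp_add]; ring_nf

theorem integrable_exp_sq_gaussianReal_var {l : ℝ} {v : NNReal} (hl : |l| * v ≤ 1 / 4) :
    Integrable (fun x => Real.exp (l * (x ^ 2 - v))) (gaussianReal 0 v) ∧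
      ∫ x, Real.exp (l * (x ^ 2 - v)) ∂gaussianReal 0 v ≤ Real.exp (2 * (l * v) ^ 2) := by
  have hmap : gaussianReal 0 v = (gaussianReal 0 1).map (√(v : ℝ) * ·) := by
    rw [gaussianReal_map_const_mul]
    congr 1
    · simp
    · ext; simp
  have hf (x : ℝ) : Real.exp (l * ((√(v : ℝ) * x) ^ 2 - v)) =
      Real.exp ((l * v) * (x ^ 2 - 1)) := by
    rw [mul_pow, Real.sq_sqrt v.coe_nonneg]; ring_nf
  have hl' : |l * v| ≤ 1 / 4 := by rwa [abs_mul, NNReal.abs_eq]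
  rw [hmap, integrable_map_measure (by fun_prop) (by fun_prop),
    integral_map (by fun_prop) (by fun_prop)]
  simp only [Function.comp_def, hf]
  exact ⟨integrable_exp_sq_gaussianReal hl', integral_exp_sq_gaussianReal_le hl'⟩

open scoped Matrix in
theorem map_inner_multivariateGaussian {p : ℕ} {S : Matrix (Fin p) (Fin p) ℝ}
    (hS : S.PosSemidef) (a : EuclideanSpace ℝ (Fin p)) :
    (multivariateGaussian 0 S).map (fun x => inner ℝ a x) =
      gaussianReal 0 (a.ofLp ⬝ᵥ S *ᵥ a.ofLp).toNNReal := by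
  have h := IsGaussian.map_eq_gaussianReal (μ := multivariateGaussian 0 S) (innerSL ℝ a)
  have h1 : ⇑(innerSL ℝ a) = fun x => inner ℝ a x := by ext; simp
  rw [ContinuousLinearMap.integral_comp_id_comm] at h
  · rw [← covariance_self (by fun_prop)] at h
    rw [h1] at h
    rw [h, ← covarianceBilin_apply_eq_cov IsGaussian.memLp_two_id,
      covarianceBilin_multivariateGaussian hS]
    simp
  · exact IsGaussian.integrable_id

open scoped Matrix in
/-- Two-sided deviation of the empirical second moment in a direction `a`. -/
theorem sampleLaw_quadratic_deviation {n p : ℕ} {S : Matrix (Fin p) (Fin p) ℝ}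
    (hS : S.PosSemidef) (a : EuclideanSpace ℝ (Fin p)) {W s : ℝ} (hW : 0 < W)
    (ha : a.ofLp ⬝ᵥ S *ᵥ a.ofLp ≤ W) (hs0 : 0 ≤ s) (hs1 : s ≤ 1) :
    (sampleLaw n p S).real {X | n * (W * s) ≤
        |∑ l, ((inner ℝ a (X l)) ^ 2 - a.ofLp ⬝ᵥ S *ᵥ a.ofLp)|} ≤
      2 * Real.exp (-(n * s ^ 2 / 8)) := by
  set v := a.ofLp ⬝ᵥ S *ᵥ a.ofLp with hv
  have hv0 : 0 ≤ v := by simpa using hS.dotProduct_mulVec_nonneg a.ofLp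
  -- The sign `e = ±1` selects the tail. With tilt `s / (4W)` the log-moment is at most `2 (s/4)² =
  -- s²/8` and the threshold is `s²/4`, leaving `-s²/8` per observation. The condition `s ≤ 1` keeps
  -- the tilt times the variance below `1/4`.
  have key (e : ℝ) (he : |e| = 1) : (sampleLaw n p S).real {X | n * (s ^ 2 / 4) ≤
      ∑ l, (e * s / (4 * W)) * ((inner ℝ a (X l)) ^ 2 - v)} ≤ Real.exp (-(n * s ^ 2 / 8)) := by
    have hl : |e * s / (4 * W)| * (v.toNNReal : ℝ) = s / 4 * (v / W) := by
      rw [abs_div, abs_mul, he, one_mul, abs_of_nonneg hs0, abs_of_pos (by positivity),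
        Real.coe_toNNReal _ hv0]
      field_simp
    have hvW : v / W ≤ 1 := (div_le_one hW).2 ha
    have hvW0 : 0 ≤ v / W := by positivity
    have hb : s / 4 * (v / W) ≤ s / 4 := mul_le_of_le_one_right (by positivity) hvW
    obtain ⟨h1, h2⟩ := integrable_exp_sq_gaussianReal_var (l := e * s / (4 * W))
      (v := v.toNNReal) (by rw [hl]; linarith)
    rw [← map_inner_multivariateGaussian hS a] at h1 h2
    rw [integrable_map_measure (by fun_prop) (by fun_prop)] at h1
    rw [integral_map (by fun_prop) (by fun_prop)] at h2
    have hsq : 2 * (e * s / (4 * W) * (v.toNNReal : ℝ)) ^ 2 ≤ s ^ 2 / 8 := by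
      rw [← sq_abs, abs_mul, NNReal.abs_eq, hl]
      have : (s / 4 * (v / W)) ^ 2 ≤ (s / 4) ^ 2 := pow_le_pow_left₀ (by positivity) hb 2
      linarith [this, show (s / 4) ^ 2 = s ^ 2 / 16 by ring]
    have h3 := h2.trans (Real.exp_le_exp.2 hsq)
    rw [Real.coe_toNNReal _ hv0] at h1 h3
    have := pi_chernoff (multivariateGaussian 0 S) h1 h3 n (s ^ 2 / 4)
    refine this.trans (le_of_eq ?_)
    congr 1; ring
  have hsub : {X : Fin n → EuclideanSpace ℝ (Fin p) | n * (W * s) ≤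
        |∑ l, ((inner ℝ a (X l)) ^ 2 - v)|} ⊆
      {X | n * (s ^ 2 / 4) ≤ ∑ l, (1 * s / (4 * W)) * ((inner ℝ a (X l)) ^ 2 - v)} ∪
      {X | n * (s ^ 2 / 4) ≤ ∑ l, ((-1) * s / (4 * W)) * ((inner ℝ a (X l)) ^ 2 - v)} := by
    intro X hX
    simp only [Set.mem_ofPred_eq, Set.mem_union, ← Finset.mul_sum] at hX ⊢
    set T := ∑ l, ((inner ℝ a (X l)) ^ 2 - v)
    have hmul (x : ℝ) (hx : n * (W * s) ≤ x) : n * (s ^ 2 / 4) ≤ s / (4 * W) * x := by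
      have := mul_le_mul_of_nonneg_left hx (show 0 ≤ s / (4 * W) by positivity)
      calc (n : ℝ) * (s ^ 2 / 4) = s / (4 * W) * (n * (W * s)) := by field_simp
        _ ≤ _ := this
    rcases le_abs.1 hX with h | h
    · left; rw [one_mul]; exact hmul _ h
    · right
      have := hmul _ h
      calc _ ≤ _ := this
        _ = _ := by ring
  have : IsProbabilityMeasure (sampleLaw n p S) := by unfold sampleLaw; infer_instance
  calc _ ≤ _ := measureReal_mono hsub
    _ ≤ _ := measureReal_union_le _ _
    _ ≤ _ := add_le_add (key 1 (by simp)) (key (-1) (by simp))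
    _ = _ := by ring

/-! ### The good event -/

open scoped Matrix MatrixOrder in
theorem quadratic_le_of_mem_covClass {p : ℕ} {ε : ℝ} {S : Matrix (Fin p) (Fin p) ℝ}
    (hS : S ∈ covClass p ε) (a : Fin p → ℝ) : a ⬝ᵥ S *ᵥ a ≤ ε⁻¹ * (a ⬝ᵥ a) := by
  obtain ⟨h, hev⟩ := hS
  have hle : S ≤ algebraMap ℝ _ ε⁻¹ := by
    refine le_algebraMap_of_spectrum_le (fun x hx => ?_) h.isHermitian
    rw [h.isHermitian.spectrum_real_eq_range_eigenvalues] at hx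
    obtain ⟨i, rfl⟩ := hx
    exact (hev i).2
  have := (Matrix.le_iff.1 hle).dotProduct_mulVec_nonneg a
  rw [Matrix.sub_mulVec, dotProduct_sub, Algebra.algebraMap_eq_smul_one, Matrix.smul_mulVec,
    Matrix.one_mulVec, dotProduct_smul, smul_eq_mul, star_trivial] at this
  linarith

/-- The event on which all entries of `Y` are close to those of the parameter. -/
def goodSet (p : ℕ) (r : ℝ) (θ : Vec p) : Set (Vec p) := {y | ∀ ij, |y ij - θ ij| ≤ r}

theorem measurableSet_goodSet (p : ℕ) (r : ℝ) (θ : Vec p) : MeasurableSet (goodSet p r θ) := by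
  have : goodSet p r θ = ⋂ ij, {y | |y ij - θ ij| ≤ r} := by
    ext; simp [goodSet]
  rw [this]
  exact MeasurableSet.iInter fun ij => measurableSet_le (by fun_prop) (by fun_prop)

instance (n p : ℕ) (S : Matrix (Fin p) (Fin p) ℝ) : IsProbabilityMeasure (sampleLaw n p S) := by
  unfold sampleLaw; infer_instance

instance (n p : ℕ) (S : Matrix (Fin p) (Fin p) ℝ) : IsProbabilityMeasure (lawY n p S) :=
  Measure.isProbabilityMeasure_map (measurable_secondMoment n p).aemeasurable

-- Diagonal entries are quadratic deviations in a coordinate direction. Off the diagonal, `4 x_i x_j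
-- = (x_i + x_j)² - (x_i - x_j)²` reduces the question to the directions `e_i ± e_j`, which doubles
-- the factor two to four.
open scoped Matrix in
theorem sampleLaw_entry_deviation {n p : ℕ} (hn : 1 ≤ n) {ε t : ℝ} (hε : 0 < ε) (ht : 0 ≤ t)
    (htε : t * ε ≤ 1) {S : Matrix (Fin p) (Fin p) ℝ} (hS : S ∈ covClass p ε) (i j : Fin p) :
    (sampleLaw n p S).real {X | t < |secondMoment X (i, j) - vec S (i, j)|} ≤
      4 * Real.exp (-(n * (t * ε) ^ 2 / 8)) := by
  have hn0 : (0 : ℝ) < n := by exact_mod_cast hn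
  have hpsd : S.PosSemidef := hS.1
  have hsymm : S j i = S i j := by simpa using hpsd.isHermitian.apply i j
  have hdev (X : Fin n → EuclideanSpace ℝ (Fin p))
      (hX : t < |secondMoment X (i, j) - vec S (i, j)|) :
      n * t ≤ |∑ l, (X l i * X l j - S i j)| := by
    have : secondMoment X (i, j) - vec S (i, j) = (n : ℝ)⁻¹ * ∑ l, (X l i * X l j - S i j) := by
      simp [secondMoment, vec, Finset.sum_sub_distrib, mul_sub, hn0.ne']
    rw [this, abs_mul, abs_of_pos (inv_pos.2 hn0), inv_mul_eq_div, lt_div_iff₀ hn0] at hX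
    linarith
  have hexp := Real.exp_pos (-(n * (t * ε) ^ 2 / 8))
  by_cases hij : i = j
  · subst hij
    let a : EuclideanSpace ℝ (Fin p) := EuclideanSpace.single i 1
    have hav : a.ofLp ⬝ᵥ S *ᵥ a.ofLp = S i i := by simp [a]
    have hq := quadratic_le_of_mem_covClass hS a.ofLp
    have haa : a.ofLp ⬝ᵥ a.ofLp = 1 := by simp [a]
    rw [haa, mul_one] at hq
    have h := sampleLaw_quadratic_deviation (n := n) hpsd a (inv_pos.2 hε) hq (by positivity) htε
    refine (measureReal_mono fun X hX => ?_).trans (h.trans (by linarith))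
    have := hdev X hX
    simp only [Set.mem_ofPred_eq, hav]
    have hin (l) : inner ℝ a (X l) = X l i := by simp [a, EuclideanSpace.inner_single_left]
    simp only [hin]
    rw [show ε⁻¹ * (t * ε) = t by field_simp]
    simpa only [sq] using this
  · let a (e : ℝ) : EuclideanSpace ℝ (Fin p) :=
      EuclideanSpace.single i 1 + e • EuclideanSpace.single j 1
    have hav (e : ℝ) : (a e).ofLp ⬝ᵥ S *ᵥ (a e).ofLp =
        S i i + 2 * e * S i j + e ^ 2 * S j j := by
      simp [a, Matrix.mulVec_add, Matrix.mulVec_smul, hsymm]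
      ring
    have haa (e : ℝ) : (a e).ofLp ⬝ᵥ (a e).ofLp = 1 + e ^ 2 := by
      simp [a, hij, Ne.symm hij]
      ring
    have hin (e : ℝ) (x : EuclideanSpace ℝ (Fin p)) : inner ℝ (a e) x = x i + e * x j := by
      simp [a, inner_add_left, inner_smul_left, EuclideanSpace.inner_single_left]
    -- The direction has squared length two, so its variance is at most `2 / ε`. A deviation of `n
    -- t` in the product forces one of the two forms to deviate by `2 n t`.
    have h (e : ℝ) (he : e ^ 2 = 1) := sampleLaw_quadratic_deviation (n := n) hpsd (a e)
      (W := ε⁻¹ * 2) (by positivity) (by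
        have := quadratic_le_of_mem_covClass hS (a e).ofLp
        rw [haa, he] at this
        linarith) (mul_nonneg ht hε.le) htε
    have hsub : {X : Fin n → EuclideanSpace ℝ (Fin p) |
        t < |secondMoment X (i, j) - vec S (i, j)|} ⊆
        {X | n * (ε⁻¹ * 2 * (t * ε)) ≤
          |∑ l, ((inner ℝ (a 1) (X l)) ^ 2 - (a 1).ofLp ⬝ᵥ S *ᵥ (a 1).ofLp)|} ∪
        {X | n * (ε⁻¹ * 2 * (t * ε)) ≤
          |∑ l, ((inner ℝ (a (-1)) (X l)) ^ 2 - (a (-1)).ofLp ⬝ᵥ S *ᵥ (a (-1)).ofLp)|} := by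
      intro X hX
      have h1 := hdev X hX
      simp only [Set.mem_union, Set.mem_ofPred_eq, hin, hav]
      rw [show ε⁻¹ * 2 * (t * ε) = 2 * t by field_simp]
      set A := ∑ l, ((X l i + 1 * X l j) ^ 2 - (S i i + 2 * 1 * S i j + 1 ^ 2 * S j j)) with hA
      set B := ∑ l, ((X l i + -1 * X l j) ^ 2 - (S i i + 2 * -1 * S i j + (-1) ^ 2 * S j j))
        with hB
      have hAB : A - B = 4 * ∑ l, (X l i * X l j - S i j) := by
        rw [hA, hB, ← Finset.sum_sub_distrib, Finset.mul_sum]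
        exact Finset.sum_congr rfl fun l _ => by ring
      by_contra! hcon
      have h2 := abs_sub A B
      rw [hAB, abs_mul, abs_of_pos (by norm_num : (0 : ℝ) < 4)] at h2
      linarith [hcon.1, hcon.2]
    calc _ ≤ _ := measureReal_mono hsub (measure_ne_top _ _)
      _ ≤ _ := measureReal_union_le _ _
      _ ≤ _ := add_le_add (h 1 (by norm_num)) (h (-1) (by norm_num))
      _ = _ := by ring

theorem lawY_goodSet_compl_le {n p : ℕ} (hn : 1 ≤ n) {ε t : ℝ} (hε : 0 < ε) (ht : 0 ≤ t)
    (htε : t * ε ≤ 1) {S : Matrix (Fin p) (Fin p) ℝ} (hS : S ∈ covClass p ε) :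
    lawY n p S (goodSet p t (vec S))ᶜ ≤
      ENNReal.ofReal (p ^ 2 * (4 * Real.exp (-(n * (t * ε) ^ 2 / 8)))) := by
  rw [lawY, Measure.map_apply (measurable_secondMoment n p) (measurableSet_goodSet ..).compl,
    ← ofReal_measureReal]
  refine ENNReal.ofReal_le_ofReal ?_
  have hsub : secondMoment ⁻¹' (goodSet p t (vec S))ᶜ ⊆
      ⋃ ij ∈ (Finset.univ : Finset (Fin p × Fin p)), {X : Fin n → EuclideanSpace ℝ (Fin p) |
        t < |secondMoment X ij - vec S ij|} := by
    intro X hX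
    simp only [Set.mem_preimage, Set.mem_compl_iff, goodSet, Set.mem_ofPred_eq, not_forall,
      not_le] at hX
    simpa using hX
  calc _ ≤ _ := measureReal_mono hsub (measure_ne_top _ _)
    _ ≤ _ := measureReal_biUnion_finset_le _ _
    _ ≤ ∑ _ij : Fin p × Fin p, 4 * Real.exp (-(n * (t * ε) ^ 2 / 8)) :=
      Finset.sum_le_sum fun ij _ => sampleLaw_entry_deviation hn hε ht htε hS ij.1 ij.2
    _ = _ := by simp; ring

theorem alphaC_pos {ε : ℝ} (hε : 0 < ε) : 0 < alphaC ε := lt_min one_pos (by positivity)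

theorem alphaC_le_one (ε : ℝ) : alphaC ε ≤ 1 := min_le_left _ _

theorem le_one_of_mem_covClass {p : ℕ} (hp : 1 ≤ p) {ε : ℝ}
    {S : Matrix (Fin p) (Fin p) ℝ} (hS : S ∈ covClass p ε) : ε ≤ 1 := by
  obtain ⟨h, hev⟩ := hS
  have h1 := (hev ⟨0, hp⟩).1.trans (hev ⟨0, hp⟩).2
  by_contra! h2
  linarith [inv_lt_one_of_one_lt₀ h2]

theorem lawY_goodSet_compl_le_remainder {n p : ℕ} (hn : 1 ≤ n) (hp : 1 ≤ p) {ε σ : ℝ}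
    (hε : 0 < ε) (hσ : 0 < σ) (hσ1 : σ ≤ 1) {S : Matrix (Fin p) (Fin p) ℝ}
    (hS : S ∈ covClass p ε) :
    lawY n p S (goodSet p (σ * √(1 / (4 * alphaC ε))) (vec S))ᶜ ≤
      ENNReal.ofReal (remainder ε n p σ) := by
  have hε1 := le_one_of_mem_covClass hp hS
  have hα := alphaC_pos hε
  have hp0 : (0 : ℝ) < p := by exact_mod_cast hp
  have hε2 : ε ^ 2 ≤ 1 := pow_le_one₀ hε.le hε1
  have hsq : (σ * √(1 / (4 * alphaC ε)) * ε) ^ 2 = σ ^ 2 * (ε ^ 2 / (4 * alphaC ε)) := by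
    rw [mul_pow, mul_pow, Real.sq_sqrt (by positivity)]; ring
  -- From `α ≤ 5ε²/4`. The exponent is then at least `n σ² / 40`, which exceeds `3 ε⁴ n σ² / 320`
  -- because `ε ≤ 1`.
  have hlow : 1 / 5 ≤ ε ^ 2 / (4 * alphaC ε) := by
    rw [le_div_iff₀ (by positivity)]
    have : alphaC ε ≤ 5 * ε ^ 2 / 4 := min_le_right _ _
    linarith
  have hup : ε ^ 2 / (4 * alphaC ε) ≤ 1 := by
    rw [div_le_one (by positivity)]
    rcases min_choice 1 (5 * ε ^ 2 / 4) with h | h <;> rw [alphaC, h] <;> nlinarith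
  have ht : σ * √(1 / (4 * alphaC ε)) * ε ≤ 1 := by
    refine (sq_le_one_iff₀ (by positivity)).1 ?_
    rw [hsq]
    exact mul_le_one₀ (pow_le_one₀ hσ.le hσ1) (by positivity) hup
  refine (lawY_goodSet_compl_le hn hε (by positivity) ht hS).trans (ENNReal.ofReal_le_ofReal ?_)
  rw [hsq, remainder, Real.exp_add, show (2 : ℝ) * Real.log p = Real.log (p ^ 2) by
    rw [Real.log_pow]; norm_num, Real.exp_log (by positivity)]
  rw [show (p : ℝ) ^ 2 * (4 * Real.exp (-(n * (σ ^ 2 * (ε ^ 2 / (4 * alphaC ε))) / 8))) =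
    4 * (Real.exp (-(n * (σ ^ 2 * (ε ^ 2 / (4 * alphaC ε))) / 8)) * p ^ 2) by ring]
  gcongr
  have hε4 : ε ^ 4 ≤ 1 := pow_le_one₀ hε.le hε1
  have h0 : 0 ≤ (n : ℝ) * σ ^ 2 := by positivity
  nlinarith [mul_le_mul_of_nonneg_left hlow h0, mul_le_mul_of_nonneg_left hε4 h0]

/-! ### Dimensions -/

theorem rho_mono {p I J : ℕ} (hIJ : I ≤ J) (hJ : J ≤ p) : rho p I ≤ rho p J := by
  rcases hIJ.eq_or_lt with rfl | h
  · exact le_rfl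
  have h1 : (I : ℝ) + 1 ≤ J := by exact_mod_cast h
  have h2 : (J : ℝ) ≤ p := by exact_mod_cast hJ
  have : rho p J - rho p I = ((J : ℝ) - I) * (2 * p - J - I - 1) / 2 := by
    simp only [rho]; ring
  have : 0 ≤ ((J : ℝ) - I) * (2 * p - J - I - 1) := mul_nonneg (by linarith) (by linarith)
  linarith

theorem le_rho {p I : ℕ} (hI : I ≤ p) : (p : ℝ) ≤ rho p I := by
  have := rho_mono (Nat.zero_le I) hI
  simpa [rho] using this

theorem one_le_rho {p I : ℕ} (hp : 1 ≤ p) (hI : I ≤ p) : 1 ≤ rho p I :=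
  (Nat.one_le_cast.2 hp).trans (le_rho hI)

theorem rho_nonneg {p I : ℕ} (hI : I ≤ p) : 0 ≤ rho p I :=
  (Nat.cast_nonneg p).trans (le_rho hI)

/-- The left side bounds the number of entries in the band, so this compares entries with dimension.
The factor `4` is what the radius `σ / √(4α)` of the good event compensates. -/
theorem mul_two_mul_add_one_le_rho {p I : ℕ} (hI : I ≤ p) :
    (p : ℝ) * (2 * I + 1) ≤ 4 * rho p I := by
  rcases hI.eq_or_lt with rfl | h
  · simp only [rho]
    nlinarith [Nat.cast_nonneg (α := ℝ) I]
  · have h1 : (I : ℝ) + 1 ≤ p := by exact_mod_cast h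
    simp only [rho]
    nlinarith [Nat.cast_nonneg (α := ℝ) I]

/-- Each term is at most `2^(-I-1)` for `I < p`, as `ρ(I) ≥ p ≥ I + 1`. The last term is at most
`2^(-p)`, exactly what completes the geometric sum to one. -/
theorem sum_exp_neg_rho_le_one (p : ℕ) :
    ∑ I : Fin (p + 1), Real.exp (-rho p I) ≤ 1 := by
  have hexp (m : ℕ) {x : ℝ} (h : (m : ℝ) ≤ x) : Real.exp (-x) ≤ (1 / 2 : ℝ) ^ m := by
    have h1 : Real.exp (-1) ≤ 1 / 2 := by
      rw [Real.exp_neg, ← one_div]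
      exact one_div_le_one_div_of_le two_pos (by linarith [Real.add_one_le_exp (1 : ℝ)])
    calc Real.exp (-x) ≤ Real.exp (m * -1) := Real.exp_le_exp.2 (by linarith)
      _ = Real.exp (-1) ^ m := Real.exp_nat_mul _ _
      _ ≤ _ := pow_le_pow_left₀ (Real.exp_pos _).le h1 m
  have hgeom (m : ℕ) : ∑ i : Fin m, (1 / 2 : ℝ) ^ ((i : ℕ) + 1) = 1 - (1 / 2) ^ m := by
    induction m with
    | zero => simp
    | succ m ih => rw [Fin.sum_univ_castSucc]; simp only [Fin.val_castSucc, ih, Fin.val_last]; ring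
  rw [Fin.sum_univ_castSucc]
  simp only [Fin.val_castSucc, Fin.val_last]
  calc _ ≤ ∑ i : Fin p, (1 / 2 : ℝ) ^ ((i : ℕ) + 1) + (1 / 2) ^ p := by
        refine add_le_add (Finset.sum_le_sum fun i _ => hexp _ ?_) (hexp _ (le_rho le_rfl))
        exact le_trans (by exact_mod_cast i.2) (le_rho i.2.le)
    _ = 1 := by rw [hgeom]; ring

theorem one_le_Cnu {ν : ℝ} (hν : 0 < ν) : 1 ≤ Cnu ν := by
  have : 0 < Real.exp ν - 1 := by linarith [Real.add_one_le_exp ν]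
  rw [Cnu, le_div_iff₀ this]
  linarith

/-! ### Projections -/

theorem bandSpace_mono (p : ℕ) {I J : ℕ} (h : I ≤ J) : bandSpace p I ≤ bandSpace p J := by
  rintro x ⟨h1, h2⟩
  exact ⟨h1, fun i j hij => h2 i j (lt_of_le_of_lt (by exact_mod_cast h) hij)⟩

theorem proj_proj {p I J : ℕ} (h : I ≤ J) (x : Vec p) : proj p I (proj p J x) = proj p I x :=
  congrArg (· x) (Submodule.starProjection_comp_starProjection_of_le (bandSpace_mono p h))

theorem proj_mem (p I : ℕ) (x : Vec p) : proj p I x ∈ bandSpace p I :=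
  Submodule.starProjection_apply_mem _ _

theorem norm_add_sq_of_mem {p I : ℕ} {u : Vec p} (x : Vec p) (hu : u ∈ bandSpace p I) :
    ‖(x - proj p I x) + u‖ ^ 2 = ‖x - proj p I x‖ ^ 2 + ‖u‖ ^ 2 := by
  have := Submodule.starProjection_inner_eq_zero (K := bandSpace p I) x u hu
  rw [sq, sq, sq]
  exact norm_add_sq_eq_norm_sq_add_norm_sq_of_inner_eq_zero _ _ this

theorem norm_sub_proj_sq {p I J : ℕ} (h : I ≤ J) (x : Vec p) :
    ‖x - proj p I x‖ ^ 2 = ‖x - proj p J x‖ ^ 2 + ‖proj p J x - proj p I x‖ ^ 2 := by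
  rw [← norm_add_sq_of_mem x (Submodule.sub_mem _ (proj_mem p J x)
    (bandSpace_mono p h (proj_mem p I x)))]
  congr 2; abel

theorem norm_proj_sub_proj_sq_le {p I J : ℕ} (h : I ≤ J) (x : Vec p) :
    ‖proj p J x - proj p I x‖ ^ 2 ≤ ‖proj p J x‖ ^ 2 := by
  have := norm_add_sq_of_mem (proj p J x) (proj_mem p I (proj p J x))
  rw [sub_add_cancel, proj_proj h] at this
  nlinarith [sq_nonneg ‖proj p I x‖]

/-- The bias is orthogonal to `𝕃_I`, while the data noise and the added noise both lie in it. -/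
theorem norm_proj_add_sub_sq (p I : ℕ) (y θ z : Vec p) :
    ‖proj p I y + proj p I z - θ‖ ^ 2 =
      ‖θ - proj p I θ‖ ^ 2 + ‖proj p I (y - θ) + proj p I z‖ ^ 2 := by
  have h := norm_add_sq_of_mem (I := I) θ
    (Submodule.neg_mem _ (Submodule.add_mem _ (proj_mem p I (y - θ)) (proj_mem p I z)))
  rw [norm_neg] at h
  rw [← h, ← norm_neg, map_sub]
  congr 2; abel

theorem norm_add_sq_le_two {p : ℕ} (x y : Vec p) :
    ‖x + y‖ ^ 2 ≤ 2 * ‖x‖ ^ 2 + 2 * ‖y‖ ^ 2 := by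
  have h := pow_le_pow_left₀ (norm_nonneg _) (norm_add_le x y) 2
  nlinarith [sq_nonneg (‖x‖ - ‖y‖)]

theorem card_band_row_le (p I : ℕ) (i : Fin p) :
    ((Finset.univ.filter fun j : Fin p => |(i : ℤ) - (j : ℤ)| ≤ I).card : ℝ) ≤ 2 * I + 1 := by
  have h : (Finset.univ.filter fun j : Fin p => |(i : ℤ) - (j : ℤ)| ≤ I).card ≤
      (Finset.Icc ((i : ℤ) - I) (i + I)).card := by
    refine Finset.card_le_card_of_injOn (fun j => (j : ℤ)) (fun j hj => ?_) (fun a _ b _ h => ?_)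
    · simp only [Finset.coe_filter, Finset.mem_univ, true_and, Set.mem_ofPred_eq] at hj
      have := abs_le.1 hj
      simp only [Finset.coe_Icc, Set.mem_Icc]
      omega
    · exact Fin.ext (Int.ofNat_inj.1 h)
  rw [Int.card_Icc, show (i : ℤ) + I + 1 - (i - I) = ((2 * I + 1 : ℕ) : ℤ) by push_cast; ring,
    Int.toNat_natCast] at h
  exact_mod_cast h

/-- Setting the entries outside the band to zero changes `x` by a vector orthogonal to `𝕃_I`, so the
projection is unaffected. What remains is contraction and a count of at most `2I + 1` entries per
row. -/
theorem norm_proj_sq_le {p I : ℕ} {x : Vec p} {r : ℝ} (hx : ∀ ij, |x ij| ≤ r) :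
    ‖proj p I x‖ ^ 2 ≤ p * (2 * I + 1) * r ^ 2 := by
  classical
  let x' : Vec p := WithLp.toLp 2 fun ij =>
    if |(ij.1 : ℤ) - (ij.2 : ℤ)| ≤ I then x ij else 0
  have hproj : proj p I x = proj p I x' := by
    rw [← sub_eq_zero, ← map_sub]
    refine (Submodule.starProjection_apply_eq_zero_iff _).2 ?_
    rw [Submodule.mem_orthogonal]
    rintro u ⟨-, hu⟩
    rw [PiLp.inner_apply]
    refine Finset.sum_eq_zero fun ij _ => ?_
    by_cases h : |(ij.1 : ℤ) - (ij.2 : ℤ)| ≤ I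
    · simp [x', h]
    · rw [hu ij.1 ij.2 (not_le.1 h)]; simp
  rw [hproj]
  have h1 : ‖proj p I x'‖ ^ 2 ≤ ‖x'‖ ^ 2 :=
    pow_le_pow_left₀ (norm_nonneg _) (Submodule.norm_starProjection_apply_le _ _) 2
  refine h1.trans ?_
  rw [EuclideanSpace.real_norm_sq_eq, Fintype.sum_prod_type]
  have hrow (i : Fin p) : ∑ j, (x' (i, j)) ^ 2 ≤ (2 * I + 1) * r ^ 2 := by
    calc ∑ j, (x' (i, j)) ^ 2 ≤ ∑ j : Fin p, if |(i : ℤ) - (j : ℤ)| ≤ I then r ^ 2 else 0 := by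
          refine Finset.sum_le_sum fun j _ => ?_
          by_cases h : |(i : ℤ) - (j : ℤ)| ≤ I
          · simp only [x', h, if_true]
            exact sq_le_sq' (abs_le.1 (hx _)).1 (abs_le.1 (hx _)).2
          · simp [x', h]
      _ = ((Finset.univ.filter fun j : Fin p => |(i : ℤ) - (j : ℤ)| ≤ I).card : ℝ) * r ^ 2 := by
          rw [← Finset.sum_filter, Finset.sum_const, nsmul_eq_mul]
      _ ≤ _ := mul_le_mul_of_nonneg_right (card_band_row_le p I i) (sq_nonneg r)
  calc _ ≤ ∑ _i : Fin p, (2 * (I : ℝ) + 1) * r ^ 2 := Finset.sum_le_sum fun i _ => hrow i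
    _ = _ := by simp; ring

/-- On the good event the projected noise is bounded by a multiple of the dimension. -/
theorem norm_proj_noise_le {p I : ℕ} (hI : I ≤ p) {α σ : ℝ} (hα : 0 < α)
    {y θ : Vec p} (hy : y ∈ goodSet p (σ * √(1 / (4 * α))) θ) :
    ‖proj p I (y - θ)‖ ^ 2 ≤ σ ^ 2 * rho p I / α := by
  refine (norm_proj_sq_le (x := y - θ) hy).trans ?_
  rw [mul_pow, Real.sq_sqrt (by positivity)]
  have h := mul_le_mul_of_nonneg_right (mul_two_mul_add_one_le_rho hI)
    (show 0 ≤ σ ^ 2 * (1 / (4 * α)) by positivity)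
  refine h.trans (le_of_eq ?_)
  field_simp

/-! ### Comparison of structures on the good event -/

/-- The penalised residual sum of squares minimised by the structure selector. -/
noncomputable def crit (p : ℕ) (σ κ : ℝ) (y : Vec p) (I : ℕ) : ℝ :=
  ‖y - proj p I y‖ ^ 2 + σ ^ 2 * (2 * κ * rho p I)

theorem rawWeight_eq {p I : ℕ} {σ κ : ℝ} (hσ : 0 < σ) (y : Vec p) :
    rawWeight p σ κ y I = Real.exp (-(crit p σ κ y I / (2 * σ ^ 2))) := by
  rw [rawWeight, crit, ← Real.exp_add]
  congr 1
  field_simp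
  ring

/-- A bad structure is either too large, and then its penalty outweighs the noise it fits, or too
small, and then its bias shows in the residual. Nestedness makes these the only cases. -/
theorem crit_add_le {p : ℕ} {α σ κ M : ℝ} (hα : 0 < α) (hα1 : α ≤ 1)
    (hκ : 5 / 2 / α + 1 / 4 ≤ κ) (hM : 0 ≤ M) {y θ : Vec p}
    (hN : ∀ I ≤ p, ‖proj p I (y - θ)‖ ^ 2 ≤ σ ^ 2 * rho p I / α) {I J : ℕ} (hI : I ≤ p)
    (hJ : J ≤ p) (hbad : c₃ α κ * localRate p (σ ^ 2) J θ + M * σ ^ 2 ≤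
      localRate p (σ ^ 2) I θ) :
    crit p σ κ y J + 2 * σ ^ 2 * (rho p I + c₂ α * M) ≤ crit p σ κ y I := by
  have hinv : 1 ≤ 1 / α := (one_le_div hα).2 hα1
  set η := 1 / α with hη
  have hκ' : 5 / 2 * η + 1 / 4 ≤ κ := by rw [hη]; convert hκ using 2; ring
  have hc₃ : c₃ α κ = 6 * η + 4 * κ := by rw [c₃, hη]; ring
  have hMs : 0 ≤ M * σ ^ 2 := by positivity
  have hc₂ : c₂ α * (M * σ ^ 2) ≤ 1 / 16 * (M * σ ^ 2) :=
    mul_le_mul_of_nonneg_right (by rw [c₂]; linarith) hMs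
  have hR : 0 ≤ σ ^ 2 * rho p I := mul_nonneg (sq_nonneg _) (rho_nonneg hI)
  have hR0 : 0 ≤ σ ^ 2 * rho p J := mul_nonneg (sq_nonneg _) (rho_nonneg hJ)
  have hA0 : 0 ≤ ‖θ - proj p J θ‖ ^ 2 := sq_nonneg _
  have hA : 0 ≤ ‖θ - proj p I θ‖ ^ 2 := sq_nonneg _
  have hNI : ‖proj p I (y - θ)‖ ^ 2 ≤ η * (σ ^ 2 * rho p I) :=
    (hN I hI).trans_eq (by rw [hη]; ring)
  have hNJ : ‖proj p J (y - θ)‖ ^ 2 ≤ η * (σ ^ 2 * rho p J) :=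
    (hN J hJ).trans_eq (by rw [hη]; ring)
  rw [hc₃] at hbad
  simp only [localRate] at hbad
  simp only [crit]
  set R := σ ^ 2 * rho p I with hRdef
  set R0 := σ ^ 2 * rho p J with hR0def
  set A := ‖θ - proj p I θ‖ ^ 2
  set A0 := ‖θ - proj p J θ‖ ^ 2
  set m := M * σ ^ 2 with hm
  have e1 : σ ^ 2 * (2 * κ * rho p J) = 2 * κ * R0 := by rw [hR0def]; ring
  have e2 : σ ^ 2 * (2 * κ * rho p I) = 2 * κ * R := by rw [hRdef]; ring
  have e3 : 2 * σ ^ 2 * (rho p I + c₂ α * M) = 2 * R + 2 * (c₂ α * m) := by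
    rw [hRdef, hm]; ring
  rw [e1, e2, e3]
  rcases le_total J I with h | h
  -- Too large: enlarging `J` to `I` lowers the residual by at most `2 A0 + 2ηR`, and `I` has no
  -- more bias than `J`, so badness must come from `R`. As `κ - η - 1 ≥ 3/4`, the penalty on `R`
  -- pays for everything.
  · have h1 := norm_sub_proj_sq h y
    have h2 := norm_sub_proj_sq h θ
    have h3 : ‖proj p I y - proj p J y‖ ^ 2 ≤ 2 * A0 + 2 * (η * R) := by
      have e : proj p I y - proj p J y =
          (proj p I θ - proj p J θ) + (proj p I (y - θ) - proj p J (y - θ)) := by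
        simp only [map_sub]; abel
      rw [e]
      refine (norm_add_sq_le_two _ _).trans ?_
      have h4 := norm_proj_sub_proj_sq_le h (y - θ)
      have : ‖proj p I θ - proj p J θ‖ ^ 2 ≤ A0 := by linarith
      linarith
    have hAA : A ≤ A0 := by nlinarith [sq_nonneg ‖proj p I θ - proj p J θ‖]
    have hR' : (6 * η + 4 * κ) * (A0 + R0) + m - A0 ≤ R := by linarith
    have hq : 3 / 4 * R ≤ (κ - η - 1) * R := mul_le_mul_of_nonneg_right (by linarith) hR
    have p1 : 0 ≤ η * A0 := by positivity
    have p2 : 0 ≤ η * R0 := by positivity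
    have p3 : 1 * A0 ≤ κ * A0 := mul_le_mul_of_nonneg_right (by linarith) hA0
    have p4 : 1 * R0 ≤ κ * R0 := mul_le_mul_of_nonneg_right (by linarith) hR0
    linarith
  -- Too small: the residual grows by at least `(A - A0) / 2 - η R0`. Half of the `4κ` in `c₃`
  -- cancels the penalty `2κ R0` of `J`, and `κ ≥ 11/4` absorbs the terms in `R`.
  · have h1 := norm_sub_proj_sq h y
    have h2 := norm_sub_proj_sq h θ
    have h3 : A - A0 ≤ 2 * ‖proj p J y - proj p I y‖ ^ 2 + 2 * (η * R0) := by
      have e : proj p J θ - proj p I θ =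
          (proj p J y - proj p I y) + -(proj p J (y - θ) - proj p I (y - θ)) := by
        simp only [map_sub]; abel
      have h5 : A - A0 = ‖proj p J θ - proj p I θ‖ ^ 2 := by linarith
      rw [h5, e]
      refine (norm_add_sq_le_two _ _).trans ?_
      rw [norm_neg]
      have h4 := norm_proj_sub_proj_sq_le h (y - θ)
      linarith
    have p1 : 0 ≤ η * A0 := by positivity
    have p2 : 0 ≤ η * R0 := by positivity
    have p3 : 1 * A0 ≤ κ * A0 := mul_le_mul_of_nonneg_right (by linarith) hA0
    have p4 : (11 / 4) * R ≤ κ * R := mul_le_mul_of_nonneg_right (by linarith) hR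
    linarith

/-! ### Weights -/

variable {p : ℕ} {σ κ : ℝ} {Ihat : Vec p → Fin (p + 1)}

theorem sum_rawWeight_pos (p : ℕ) (σ κ : ℝ) (y : Vec p) :
    0 < ∑ J : Fin (p + 1), rawWeight p σ κ y J :=
  Finset.sum_pos (fun J _ => by unfold rawWeight; positivity) Finset.univ_nonempty

theorem weight_nonneg (y : Vec p) (I : Fin (p + 1)) (k : Procedure) :
    0 ≤ weight p σ κ Ihat y I k := by
  cases k
  · exact div_nonneg (by unfold rawWeight; positivity) (sum_rawWeight_pos p σ κ y).le
  · simp only [weight]; split_ifs <;> norm_num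

theorem sum_weight (y : Vec p) (k : Procedure) :
    ∑ I, weight p σ κ Ihat y I k = 1 := by
  cases k
  · simp only [weight]
    rw [← Finset.sum_div, div_self (sum_rawWeight_pos p σ κ y).ne']
  · simp [weight]

/-- For averaging, the normalising sum is bounded below by its term at `J`. For selection, the
criterion gap is strictly positive, so `I` cannot be the minimiser and its weight vanishes. -/
theorem weight_le_exp (hp : 1 ≤ p) {α M : ℝ} (hσ : 0 < σ) (hα : 0 < α) (hα1 : α ≤ 1)
    (hκ : 5 / 2 / α + 1 / 4 ≤ κ) (hM : 0 ≤ M) (hI : IsSelector p σ κ Ihat) {y θ : Vec p}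
    (hN : ∀ I ≤ p, ‖proj p I (y - θ)‖ ^ 2 ≤ σ ^ 2 * rho p I / α) (k : Procedure)
    {I J : Fin (p + 1)}
    (hbad : c₃ α κ * localRate p (σ ^ 2) J θ + M * σ ^ 2 ≤ localRate p (σ ^ 2) I θ) :
    weight p σ κ Ihat y I k ≤ Real.exp (-rho p I - c₂ α * M) := by
  have hcrit := crit_add_le hα hα1 hκ hM hN (Nat.lt_succ_iff.1 I.2) (Nat.lt_succ_iff.1 J.2) hbad
  cases k
  · simp only [weight]
    rw [div_le_iff₀ (sum_rawWeight_pos p σ κ y)]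
    have h1 : rawWeight p σ κ y J ≤ ∑ J : Fin (p + 1), rawWeight p σ κ y J :=
      Finset.single_le_sum (f := fun J : Fin (p + 1) => rawWeight p σ κ y J)
        (fun J _ => by unfold rawWeight; positivity) (Finset.mem_univ J)
    refine le_trans ?_ (mul_le_mul_of_nonneg_left h1 (Real.exp_pos _).le)
    rw [rawWeight_eq hσ, rawWeight_eq hσ, ← Real.exp_add, Real.exp_le_exp]
    have h2 := div_le_div_of_nonneg_right hcrit (show 0 ≤ 2 * σ ^ 2 by positivity)
    rw [add_div, mul_div_cancel_left₀ _ (by positivity)] at h2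
    linarith
  · simp only [weight]
    split_ifs with h
    · subst h
      exfalso
      have h1 := hI.2 y J
      have h2 : 0 < 2 * σ ^ 2 * (rho p (Ihat y) + c₂ α * M) := by
        have := one_le_rho hp (Nat.lt_succ_iff.1 (Ihat y).2)
        have : 0 ≤ c₂ α * M := by unfold c₂; positivity
        positivity
      simp only [crit] at hcrit
      linarith
    · positivity

theorem structProb_le_exp (hp : 1 ≤ p) {α M : ℝ} (hσ : 0 < σ) (hα : 0 < α) (hα1 : α ≤ 1)
    (hκ : 5 / 2 / α + 1 / 4 ≤ κ) (hM : 0 ≤ M) (hI : IsSelector p σ κ Ihat) {y θ : Vec p}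
    (hN : ∀ I ≤ p, ‖proj p I (y - θ)‖ ^ 2 ≤ σ ^ 2 * rho p I / α) (k : Procedure)
    (J : Fin (p + 1)) :
    structProb p σ κ Ihat k y {I | c₃ α κ * localRate p (σ ^ 2) J θ + M * σ ^ 2 ≤
      localRate p (σ ^ 2) I θ} ≤ Real.exp (-c₂ α * M) := by
  classical
  calc _ ≤ ∑ I : Fin (p + 1), Real.exp (-rho p I) * Real.exp (-c₂ α * M) := by
        refine Finset.sum_le_sum fun I _ => ?_
        split_ifs with h
        · refine (weight_le_exp hp hσ hα hα1 hκ hM hI hN k h).trans_eq ?_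
          rw [← Real.exp_add]; ring_nf
        · positivity
    _ ≤ 1 * Real.exp (-c₂ α * M) := by
        rw [← Finset.sum_mul]
        exact mul_le_mul_of_nonneg_right (sum_exp_neg_rho_le_one p) (Real.exp_pos _).le
    _ = _ := one_mul _

theorem localRate_Ihat_lt (hp : 1 ≤ p) {α M : ℝ} (hσ : 0 < σ) (hα : 0 < α) (hα1 : α ≤ 1)
    (hκ : 5 / 2 / α + 1 / 4 ≤ κ) (hM : 0 ≤ M) (hI : IsSelector p σ κ Ihat) {y θ : Vec p}
    (hN : ∀ I ≤ p, ‖proj p I (y - θ)‖ ^ 2 ≤ σ ^ 2 * rho p I / α) (J : Fin (p + 1)) :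
    localRate p (σ ^ 2) (Ihat y) θ < c₃ α κ * localRate p (σ ^ 2) J θ + M * σ ^ 2 := by
  by_contra! h
  -- Selection puts weight one on `Ihat y`, whereas a bad structure has weight below one.
  have h1 := weight_le_exp hp hσ hα hα1 hκ hM hI hN .selection h
  simp only [weight, if_true] at h1
  have h2 : Real.exp (-rho p (Ihat y) - c₂ α * M) < 1 := by
    rw [Real.exp_lt_one_iff]
    have := one_le_rho hp (Nat.lt_succ_iff.1 (Ihat y).2)
    have : 0 ≤ c₂ α * M := by unfold c₂; positivity
    linarith
  linarith

theorem localRate_nonneg {s : ℝ} (hs : 0 ≤ s) (I : Fin (p + 1)) (θ : Vec p) :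
    0 ≤ localRate p s I θ :=
  add_nonneg (sq_nonneg _) (mul_nonneg hs (rho_nonneg (Nat.lt_succ_iff.1 I.2)))

theorem norm_proj_sub_sq_le {α : ℝ} (hα : 0 < α) (hα1 : α ≤ 1) {y θ : Vec p}
    (hN : ∀ I ≤ p, ‖proj p I (y - θ)‖ ^ 2 ≤ σ ^ 2 * rho p I / α) (I : Fin (p + 1)) :
    ‖proj p I y - θ‖ ^ 2 ≤ localRate p (σ ^ 2) I θ / α := by
  have h := norm_proj_add_sub_sq p I y θ 0
  rw [map_zero, add_zero, add_zero] at h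
  rw [h, localRate, add_div]
  exact add_le_add (le_div_self (sq_nonneg _) hα hα1) (hN I (Nat.lt_succ_iff.1 I.2))

theorem norm_estimator_sub_sq_le (y θ : Vec p) (k : Procedure) :
    ‖estimator p σ κ Ihat k y - θ‖ ^ 2 ≤
      ∑ I : Fin (p + 1), weight p σ κ Ihat y I k * ‖proj p I y - θ‖ ^ 2 := by
  have h1 : estimator p σ κ Ihat k y - θ =
      ∑ I : Fin (p + 1), weight p σ κ Ihat y I k • (proj p I y - θ) := by
    simp only [smul_sub, Finset.sum_sub_distrib, ← Finset.sum_smul, sum_weight, one_smul,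
      estimator]
  have h2 : ‖estimator p σ κ Ihat k y - θ‖ ≤
      ∑ I : Fin (p + 1), weight p σ κ Ihat y I k * ‖proj p I y - θ‖ := by
    rw [h1]
    refine (norm_sum_le _ _).trans_eq (Finset.sum_congr rfl fun I _ => ?_)
    rw [norm_smul, Real.norm_of_nonneg (weight_nonneg _ _ _)]
  exact (pow_le_pow_left₀ (norm_nonneg _) h2 2).trans
    (Real.pow_arith_mean_le_arith_mean_pow _ _ _ (fun I _ => weight_nonneg _ _ _)
      (sum_weight y k) (fun I _ => norm_nonneg _) 2)

/-- The exponentially small weights of bad structures beat their linearly growing losses, so the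
bound is deterministic and needs no term `M σ²`. The reference `J` is arbitrary, which lets a
`τ₀`-oracle play its role in the coverage bound. -/
theorem norm_estimator_sub_sq_lt (hp : 1 ≤ p) {α ν : ℝ} (hσ : 0 < σ) (hα : 0 < α)
    (hα1 : α ≤ 1) (hν : 0 < ν) (hκ : 5 / 2 / α + 1 / 4 ≤ κ) (hI : IsSelector p σ κ Ihat)
    {y θ : Vec p} (hN : ∀ I ≤ p, ‖proj p I (y - θ)‖ ^ 2 ≤ σ ^ 2 * rho p I / α)
    (k : Procedure) (J : Fin (p + 1)) :
    ‖estimator p σ κ Ihat k y - θ‖ ^ 2 < M₁ α ν κ * localRate p (σ ^ 2) J θ := by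
  have hs : 0 < σ ^ 2 := by positivity
  have hr0 : 0 ≤ localRate p (σ ^ 2) J θ := localRate_nonneg hs.le J θ
  have hr1 : σ ^ 2 ≤ localRate p (σ ^ 2) J θ := by
    have := mul_le_mul_of_nonneg_left (one_le_rho hp (Nat.lt_succ_iff.1 J.2)) hs.le
    rw [localRate]
    nlinarith [sq_nonneg ‖θ - proj p J θ‖]
  have hκ0 : 0 < κ := lt_of_lt_of_le (by positivity) hκ
  have hc0 : 0 < c₃ α κ := by unfold c₃; positivity
  have hc16 : 16 / α ≤ c₃ α κ := by
    have : 16 / α = 6 / α + 4 * (5 / 2 / α) := by field_simp; norm_num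
    rw [c₃]; linarith
  set r := localRate p (σ ^ 2) J θ
  have hterm (I : Fin (p + 1)) : weight p σ κ Ihat y I k * ‖proj p I y - θ‖ ^ 2 ≤
      1 / α * (weight p σ κ Ihat y I k * (c₃ α κ * r) +
        Real.exp (-rho p I) * (16 / α * σ ^ 2)) := by
    have hw := weight_nonneg (σ := σ) (κ := κ) (Ihat := Ihat) y I k
    have h1 := mul_le_mul_of_nonneg_left (norm_proj_sub_sq_le hα hα1 hN I) hw
    refine h1.trans ?_
    rw [div_eq_mul_one_div, ← mul_assoc, mul_comm]
    refine mul_le_mul_of_nonneg_left ?_ (by positivity)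
    rcases le_total (localRate p (σ ^ 2) I θ) (c₃ α κ * r) with h | h
    · have := mul_le_mul_of_nonneg_left h hw
      have : 0 ≤ Real.exp (-rho p I) * (16 / α * σ ^ 2) := by positivity
      linarith
    -- Each bad structure is tested at its own excess `x`. Then `x exp (-c₂ x) ≤ 1 / c₂ = 16 / α`,
    -- and the factor `exp (-ρ(I))` keeps the sum finite uniformly in `p`.
    · set x := (localRate p (σ ^ 2) I θ - c₃ α κ * r) / σ ^ 2 with hx
      have hx0 : 0 ≤ x := div_nonneg (by linarith) hs.le
      have hxe : localRate p (σ ^ 2) I θ = c₃ α κ * r + x * σ ^ 2 := by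
        rw [hx, div_mul_cancel₀ _ hs.ne']; ring
      have hw2 := weight_le_exp hp hσ hα hα1 hκ hx0 hI hN k hxe.symm.le
      have h3 : Real.exp (-rho p I - c₂ α * x) * x ≤ Real.exp (-rho p I) * (16 / α) := by
        rw [sub_eq_add_neg, Real.exp_add, mul_assoc]
        refine mul_le_mul_of_nonneg_left ?_ (Real.exp_pos _).le
        rw [Real.exp_neg, inv_mul_le_iff₀ (Real.exp_pos _)]
        have h4 : c₂ α * x ≤ Real.exp (c₂ α * x) := by linarith [Real.add_one_le_exp (c₂ α * x)]
        have h5 := mul_le_mul_of_nonneg_right h4 (show 0 ≤ 16 / α by positivity)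
        refine le_trans (le_of_eq ?_) h5
        rw [c₂]; field_simp
      have h4 := (mul_le_mul_of_nonneg_right hw2 hx0).trans h3
      have h5 := mul_le_mul_of_nonneg_right h4 hs.le
      rw [hxe]
      linarith
  have hsum : ‖estimator p σ κ Ihat k y - θ‖ ^ 2 ≤
      1 / α * (c₃ α κ * r + 16 / α * σ ^ 2) := by
    refine (norm_estimator_sub_sq_le y θ k).trans ((Finset.sum_le_sum fun I _ => hterm I).trans ?_)
    rw [← Finset.mul_sum, Finset.sum_add_distrib, ← Finset.sum_mul, ← Finset.sum_mul, sum_weight,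
      one_mul]
    have := mul_le_mul_of_nonneg_right (sum_exp_neg_rho_le_one p)
      (show 0 ≤ 16 / α * σ ^ 2 by positivity)
    exact mul_le_mul_of_nonneg_left (by linarith) (by positivity)
  have hcr : 0 < c₃ α κ * r := mul_pos hc0 (by linarith)
  have h16 : 16 / α * σ ^ 2 ≤ c₃ α κ * r := mul_le_mul hc16 hr1 hs.le hc0.le
  refine hsum.trans_lt ?_
  have e : M₁ α ν κ * r = 1 / α * (12 * (ν + 1) * (c₃ α κ * r)) := by rw [M₁]; ring
  rw [e]
  refine mul_lt_mul_of_pos_left ?_ (by positivity)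
  nlinarith

/-! ### The size of the selected structure and the confidence radius -/

/-- If the selected structure were much smaller than the `τ₀`-oracle `I`, optimality of `I` would
give a bias gap of at least `τ₀ σ² d`, where `d` is the dimension gap. The selector tolerates a data
gap of only `2κ σ² d`, and the noise cannot cover the difference. -/
theorem mul_rho_le_rho_Ihat {α δ τ₀ : ℝ} (hp : 1 ≤ p) (hσ : 0 < σ) (hα : 0 < α) (hκ : 0 < κ)
    (hδ : δ ∈ Set.Ioo (0 : ℝ) 1) (hτ₀ : (1 + δ) / (1 - δ) * tauBar α κ < τ₀)
    (hI : IsSelector p σ κ Ihat) {y θ : Vec p}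
    (hN : ∀ I ≤ p, ‖proj p I (y - θ)‖ ^ 2 ≤ σ ^ 2 * rho p I / α) {I : Fin (p + 1)}
    (horacle : ∀ J : Fin (p + 1),
      localRate p (τ₀ * σ ^ 2) I θ ≤ localRate p (τ₀ * σ ^ 2) J θ) :
    δ * rho p I ≤ rho p (Ihat y) := by
  obtain ⟨hδ0, hδ1⟩ := hδ
  have hρ := one_le_rho hp (Nat.lt_succ_iff.1 I.2)
  rcases le_total (I : ℕ) (Ihat y : ℕ) with h | h
  · have := rho_mono h (Nat.lt_succ_iff.1 (Ihat y).2)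
    nlinarith
  by_contra! hlt
  have hs : 0 < σ ^ 2 := by positivity
  have h1 := norm_sub_proj_sq h y
  have h2 := norm_sub_proj_sq h θ
  have h3 := hI.2 y I
  have h4 := horacle (Ihat y)
  simp only [localRate] at h4
  set P := proj p I (y - θ) - proj p (Ihat y) (y - θ) with hP
  have h5 : ‖P‖ ^ 2 ≤ σ ^ 2 * rho p I / α :=
    (norm_proj_sub_proj_sq_le h (y - θ)).trans (hN I (Nat.lt_succ_iff.1 I.2))
  have e : proj p I θ - proj p (Ihat y) θ = (proj p I y - proj p (Ihat y) y) + -P := by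
    rw [hP]; simp only [map_sub]; abel
  -- The weights `3/2` and `3` produce `3κ` and `3/α`, whose sum is `tauBar`.
  have h6 : ‖proj p I θ - proj p (Ihat y) θ‖ ^ 2 ≤
      3 / 2 * ‖proj p I y - proj p (Ihat y) y‖ ^ 2 + 3 * ‖P‖ ^ 2 := by
    rw [e]
    have := pow_le_pow_left₀ (norm_nonneg _) (norm_add_le (proj p I y - proj p (Ihat y) y) (-P)) 2
    rw [norm_neg] at this
    nlinarith [sq_nonneg (‖proj p I y - proj p (Ihat y) y‖ - 2 * ‖P‖)]
  set d := rho p I - rho p (Ihat y) with hd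
  have hd0 : (1 - δ) * rho p I < d := by linarith
  have h7 : τ₀ * d * σ ^ 2 ≤ (3 * κ * d + 3 * (rho p I / α)) * σ ^ 2 := by
    have e1 : σ ^ 2 * rho p I / α = rho p I / α * σ ^ 2 := by ring
    rw [e1] at h5
    rw [hd]
    linarith
  have h8 := le_of_mul_le_mul_right h7 hs
  have h1δ : 0 < 1 - δ := by linarith
  have hdpos : 0 < d := lt_trans (by positivity) hd0
  have h9 : (1 - δ) * τ₀ > (1 + δ) * (3 * κ + 3 * (1 / α)) := by
    have := mul_lt_mul_of_pos_left hτ₀ h1δ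
    have e2 : (1 - δ) * ((1 + δ) / (1 - δ) * tauBar α κ) =
        (1 + δ) * (3 * κ + 3 * (1 / α)) := by
      rw [tauBar]; field_simp; ring
    linarith
  have h10 : (1 - δ) * (rho p I / α) ≤ d * (1 / α) := by
    rw [div_eq_mul_one_div, ← mul_assoc]
    exact mul_le_mul_of_nonneg_right hd0.le (by positivity)
  have h11 := mul_le_mul_of_nonneg_left h8 h1δ.le
  have h12 := mul_lt_mul_of_pos_right h9 hdpos
  have hη : 0 < 1 / α := by positivity
  have p1 : 0 < δ * (κ * d) := by positivity
  have p2 : 0 < δ * (1 / α * d) := by positivity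
  nlinarith

theorem M₁_mul_oracle_le_radius_sq {α ν δ τ₀ t M : ℝ} (hp : 1 ≤ p) (hσ : 0 < σ) (hα : 0 < α)
    (hν : 0 < ν) (hκ : 0 < κ) (hδ : δ ∈ Set.Ioo (0 : ℝ) 1)
    (hτ₀ : (1 + δ) / (1 - δ) * tauBar α κ < τ₀) (ht : 0 ≤ t) (hM : 0 ≤ M)
    (hI : IsSelector p σ κ Ihat) {y θ : Vec p}
    (hN : ∀ I ≤ p, ‖proj p I (y - θ)‖ ^ 2 ≤ σ ^ 2 * rho p I / α) {I : Fin (p + 1)}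
    (horacle : ∀ J : Fin (p + 1),
      localRate p (τ₀ * σ ^ 2) I θ ≤ localRate p (τ₀ * σ ^ 2) J θ)
    (hebr : ‖θ - proj p I θ‖ ^ 2 ≤ t * σ ^ 2 * (1 + rho p I)) :
    M₁ α ν κ * localRate p (σ ^ 2) I θ ≤
      (t + 1) * M₂ α ν κ δ * rhatSq p σ Ihat y + (t + 2) * M * σ ^ 2 := by
  have hρ := mul_rho_le_rho_Ihat hp hσ hα hκ hδ hτ₀ hI hN horacle
  obtain ⟨hδ0, hδ1⟩ := hδ
  have hM₁ : 0 ≤ M₁ α ν κ := by unfold M₁ c₃; positivity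
  have h1 : localRate p (σ ^ 2) I θ ≤ (t + 1) * σ ^ 2 * (1 + rho p I) := by
    rw [localRate]; nlinarith [sq_nonneg σ]
  have h2 : 1 + rho p I ≤ (1 + rho p (Ihat y)) / δ := by
    rw [le_div_iff₀ hδ0]; linarith
  have h3 : 0 ≤ (t + 2) * M * σ ^ 2 := by positivity
  calc _ ≤ M₁ α ν κ * ((t + 1) * σ ^ 2 * ((1 + rho p (Ihat y)) / δ)) :=
        mul_le_mul_of_nonneg_left
          (h1.trans (mul_le_mul_of_nonneg_left h2 (by positivity))) hM₁
    _ = (t + 1) * M₂ α ν κ δ * rhatSq p σ Ihat y := by rw [M₂, rhatSq]; ring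
    _ ≤ _ := by linarith

/-! ### The data dependent measure -/

theorem IsNoiseLaw.measure_le {p : ℕ} {α : ℝ} {PZ : Measure (Vec p)} (hPZ : IsNoiseLaw p α PZ)
    (I : Fin (p + 1)) (q : ℝ) :
    PZ {z | q ≤ α * ‖proj p I z‖ ^ 2} ≤ ENNReal.ofReal (Real.exp (rho p I - q)) := by
  have h := mul_meas_ge_le_lintegral (μ := PZ)
    (f := fun z => ENNReal.ofReal (Real.exp (α * ‖proj p I z‖ ^ 2))) (by fun_prop)
    (ENNReal.ofReal (Real.exp q))
  have hset : {z | ENNReal.ofReal (Real.exp q) ≤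
      ENNReal.ofReal (Real.exp (α * ‖proj p I z‖ ^ 2))} = {z | q ≤ α * ‖proj p I z‖ ^ 2} := by
    ext z
    simp [ENNReal.ofReal_le_ofReal_iff (Real.exp_pos _).le]
  rw [hset] at h
  have h1 := h.trans (hPZ.expMoment I)
  rw [Real.exp_sub, ENNReal.ofReal_div_of_pos (Real.exp_pos q)]
  refine ENNReal.le_div_iff_mul_le (Or.inl ?_) (Or.inl ENNReal.ofReal_ne_top) |>.2 ?_
  · simpa using Real.exp_pos q
  · rwa [mul_comm]

theorem ddm_apply (PZ : Measure (Vec p)) (k : Procedure) (y : Vec p) {A : Set (Vec p)}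
    (hA : MeasurableSet A) :
    ddm p σ κ Ihat PZ k y A = ∑ I : Fin (p + 1), ENNReal.ofReal (weight p σ κ Ihat y I k) *
      PZ {z | proj p I y + σ • proj p I z ∈ A} := by
  simp only [ddm, Measure.coe_finsetSum, Finset.sum_apply, Measure.smul_apply, smul_eq_mul]
  refine Finset.sum_congr rfl fun I _ => ?_
  rw [Measure.map_apply (by fun_prop) hA]
  rfl

theorem ddm_apply_le_one {PZ : Measure (Vec p)} [IsProbabilityMeasure PZ] (k : Procedure)
    (y : Vec p) {A : Set (Vec p)} (hA : MeasurableSet A) :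
    ddm p σ κ Ihat PZ k y A ≤ 1 := by
  rw [ddm_apply PZ k y hA]
  calc _ ≤ ∑ I : Fin (p + 1), ENNReal.ofReal (weight p σ κ Ihat y I k) :=
        Finset.sum_le_sum fun I _ => mul_le_of_le_one_right' prob_le_one
    _ = 1 := by
        rw [← ENNReal.ofReal_sum_of_nonneg fun I _ => weight_nonneg _ _ _, sum_weight,
          ENNReal.ofReal_one]

theorem structProb_le_one (k : Procedure) (y : Vec p) (G : Set (Fin (p + 1))) :
    structProb p σ κ Ihat k y G ≤ 1 := by
  classical
  rw [← sum_weight (σ := σ) (κ := κ) (Ihat := Ihat) y k]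
  refine Finset.sum_le_sum fun I _ => ?_
  split_ifs
  · exact le_rfl
  · exact weight_nonneg _ _ _

theorem noise_component_le {α ν M : ℝ} {PZ : Measure (Vec p)} (hPZ : IsNoiseLaw p α PZ)
    (hσ : 0 < σ) (hα : 0 < α) (hα1 : α ≤ 1) (hν : 0 < ν) (hκ : 0 < κ) (hM : 0 ≤ M)
    {y θ : Vec p} (hN : ∀ I ≤ p, ‖proj p I (y - θ)‖ ^ 2 ≤ σ ^ 2 * rho p I / α)
    {I J : Fin (p + 1)}
    (hgood : localRate p (σ ^ 2) I θ ≤ c₃ α κ * localRate p (σ ^ 2) J θ +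
      α / (4 * (2 * ν + 2 * α + 4)) * M * σ ^ 2) :
    PZ {z | M₀ α ν κ * localRate p (σ ^ 2) J θ + M * σ ^ 2 ≤
        ‖proj p I y + σ • proj p I z - θ‖ ^ 2} ≤
      ENNReal.ofReal (Real.exp (-m₀ α ν * M)) := by
  have hs : 0 < σ ^ 2 := by positivity
  have hr0 : 0 ≤ localRate p (σ ^ 2) J θ := localRate_nonneg hs.le J θ
  set r0 := localRate p (σ ^ 2) J θ
  set r := localRate p (σ ^ 2) I θ with hr
  have hρr : σ ^ 2 * rho p I ≤ r := by
    rw [hr, localRate]; linarith [sq_nonneg ‖θ - proj p I θ‖]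
  -- The level that `α ‖P_I z‖²` must reach for the deviation to occur, once the bias and twice the
  -- data noise are charged to the local rate of `I`.
  set q := (α / 2 * (M₀ α ν κ * r0 + M * σ ^ 2) - r) / σ ^ 2 with hq
  have hsub : {z | M₀ α ν κ * r0 + M * σ ^ 2 ≤ ‖proj p I y + σ • proj p I z - θ‖ ^ 2} ⊆
      {z | q ≤ α * ‖proj p I z‖ ^ 2} := by
    intro z hz
    simp only [Set.mem_ofPred_eq] at hz ⊢
    have h := norm_proj_add_sub_sq p I y θ (σ • z)
    rw [map_smul] at h
    have h1 := norm_add_sq_le_two (proj p I (y - θ)) (σ • proj p I z)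
    rw [norm_smul, mul_pow, Real.norm_eq_abs, sq_abs] at h1
    have h2 := hN I (Nat.lt_succ_iff.1 I.2)
    rw [le_div_iff₀ hα] at h2
    rw [hq, div_le_iff₀ hs]
    rw [h] at hz
    have h3 : α * ‖θ - proj p I θ‖ ^ 2 ≤ 2 * ‖θ - proj p I θ‖ ^ 2 :=
      mul_le_mul_of_nonneg_right (by linarith) (sq_nonneg _)
    have h4 := mul_le_mul_of_nonneg_left (hz.trans (add_le_add le_rfl h1)) hα.le
    rw [hr, localRate]
    linarith
  refine (measure_mono hsub).trans ((hPZ.measure_le I q).trans ?_)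
  refine ENNReal.ofReal_le_ofReal (Real.exp_le_exp.2 ?_)
  have hmain : σ ^ 2 * rho p I + r - α / 2 * (M₀ α ν κ * r0 + M * σ ^ 2) ≤
      (-m₀ α ν * M) * σ ^ 2 := by
    have hMs : 0 ≤ M * σ ^ 2 := by positivity
    have hc0 : 0 < c₃ α κ := by unfold c₃; positivity
    have e1 : α / 2 * (M₀ α ν κ * r0 + M * σ ^ 2) =
        (ν + α + 2) * (c₃ α κ * r0) + α / 2 * (M * σ ^ 2) := by
      rw [M₀]; field_simp; ring
    have h1 : 2 * (c₃ α κ * r0) ≤ (ν + α + 2) * (c₃ α κ * r0) :=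
      mul_le_mul_of_nonneg_right (by linarith) (by positivity)
    have h2 : α / (4 * (2 * ν + 2 * α + 4)) ≤ α / 16 :=
      div_le_div_of_nonneg_left hα.le (by norm_num) (by linarith)
    have h3 := mul_le_mul_of_nonneg_right h2 hMs
    have h4 : m₀ α ν ≤ α / 8 := min_le_left _ _
    have h5 := mul_le_mul_of_nonneg_right h4 hMs
    have h6 : 0 ≤ α * (M * σ ^ 2) := by positivity
    linarith
  rw [hq]
  have h := div_le_div_of_nonneg_right hmain hs.le
  rw [mul_div_cancel_right₀ _ hs.ne'] at h
  refine le_trans (le_of_eq ?_) h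
  field_simp
  ring

/-- Structures are split at excess level `M' = α M / (4 (2ν + 2α + 4))`. Those above it are charged
their whole weight, the others the noise tail. Each share is at most `exp (-m₀ M)`, and `2 ≤ H₀`. -/
theorem ddm_tail_le {α ν M : ℝ} {PZ : Measure (Vec p)} (hPZ : IsNoiseLaw p α PZ) (hp : 1 ≤ p)
    (hσ : 0 < σ) (hα : 0 < α) (hα1 : α ≤ 1) (hν : 0 < ν) (hκ : 5 / 2 / α + 1 / 4 ≤ κ)
    (hM : 0 ≤ M) (hI : IsSelector p σ κ Ihat) {y θ : Vec p}
    (hN : ∀ I ≤ p, ‖proj p I (y - θ)‖ ^ 2 ≤ σ ^ 2 * rho p I / α) (k : Procedure)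
    (J : Fin (p + 1)) :
    ddm p σ κ Ihat PZ k y
        {ϑ | M₀ α ν κ * localRate p (σ ^ 2) J θ + M * σ ^ 2 ≤ ‖ϑ - θ‖ ^ 2} ≤
      ENNReal.ofReal (H₀ ν * Real.exp (-m₀ α ν * M)) := by
  classical
  have := hPZ.isProb
  have hκ0 : 0 < κ := lt_of_lt_of_le (by positivity) hκ
  rw [ddm_apply PZ k y (measurableSet_le (by fun_prop) (by fun_prop))]
  set M' := α / (4 * (2 * ν + 2 * α + 4)) * M with hM'
  have hM'0 : 0 ≤ M' := by positivity
  set G : Set (Fin (p + 1)) := {I | c₃ α κ * localRate p (σ ^ 2) J θ + M' * σ ^ 2 ≤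
    localRate p (σ ^ 2) I θ} with hG
  have hterm (I : Fin (p + 1)) : ENNReal.ofReal (weight p σ κ Ihat y I k) *
      PZ {z | proj p I y + σ • proj p I z ∈
        {ϑ | M₀ α ν κ * localRate p (σ ^ 2) J θ + M * σ ^ 2 ≤ ‖ϑ - θ‖ ^ 2}} ≤
      ENNReal.ofReal (weight p σ κ Ihat y I k * Real.exp (-m₀ α ν * M) +
        if I ∈ G then weight p σ κ Ihat y I k else 0) := by
    have hw := weight_nonneg (σ := σ) (κ := κ) (Ihat := Ihat) y I k
    by_cases h : I ∈ G
    · rw [if_pos h]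
      refine (mul_le_of_le_one_right' prob_le_one).trans (ENNReal.ofReal_le_ofReal ?_)
      have : 0 ≤ weight p σ κ Ihat y I k * Real.exp (-m₀ α ν * M) := by positivity
      linarith
    · rw [if_neg h, add_zero, ENNReal.ofReal_mul hw]
      gcongr
      exact noise_component_le hPZ hσ hα hα1 hν hκ0 hM hN (not_le.1 h).le
  refine (Finset.sum_le_sum fun I _ => hterm I).trans ?_
  rw [← ENNReal.ofReal_sum_of_nonneg fun I _ => ?_]
  · refine ENNReal.ofReal_le_ofReal ?_
    rw [Finset.sum_add_distrib, ← Finset.sum_mul, sum_weight, one_mul]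
    have h1 := structProb_le_exp hp hσ hα hα1 hκ hM'0 hI hN k J
    have h2 : Real.exp (-c₂ α * M') ≤ Real.exp (-m₀ α ν * M) := by
      refine Real.exp_le_exp.2 ?_
      have : m₀ α ν ≤ c₂ α * (α / (4 * (2 * ν + 2 * α + 4))) :=
        (min_le_right _ _).trans (min_le_left _ _)
      have := mul_le_mul_of_nonneg_right this hM
      rw [hM']
      linarith
    have h3 : 2 * Real.exp (-m₀ α ν * M) ≤ H₀ ν * Real.exp (-m₀ α ν * M) :=
      mul_le_mul_of_nonneg_right (by rw [H₀]; linarith [one_le_Cnu hν]) (Real.exp_pos _).le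
    have h4 : structProb p σ κ Ihat k y G =
        ∑ I : Fin (p + 1), if I ∈ G then weight p σ κ Ihat y I k else 0 :=
      Finset.sum_congr rfl fun I _ => by congr
    rw [← h4]
    linarith
  · have := weight_nonneg (σ := σ) (κ := κ) (Ihat := Ihat) y I k
    split_ifs <;> positivity

/-! ### Transfer from the good event -/

/-- The integrand is dominated by an indicator plus a constant, so its measurability is never
needed. -/
theorem lintegral_le_of_le_on {Ω : Type*} [MeasurableSpace Ω] {μ : Measure Ω}
    [IsProbabilityMeasure μ] {E : Set Ω} (hE : MeasurableSet E) {f : Ω → ℝ≥0∞} {r b : ℝ}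
    (hr : 0 ≤ r) (hb : 0 ≤ b) (hμ : μ Eᶜ ≤ ENNReal.ofReal r) (hf : ∀ x, f x ≤ 1)
    (hfE : ∀ x ∈ E, f x ≤ ENNReal.ofReal b) : ∫⁻ x, f x ∂μ ≤ ENNReal.ofReal (r + b) := by
  calc ∫⁻ x, f x ∂μ ≤ ∫⁻ x, (Eᶜ.indicator 1 x + ENNReal.ofReal b) ∂μ := by
        refine lintegral_mono fun x => ?_
        by_cases h : x ∈ E
        · exact (hfE x h).trans le_add_self
        · simpa [h] using (hf x).trans le_self_add
    _ = μ Eᶜ + ENNReal.ofReal b := by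
        rw [lintegral_add_right _ measurable_const, lintegral_indicator_one hE.compl,
          lintegral_const, measure_univ, mul_one]
    _ ≤ _ := by rw [ENNReal.ofReal_add hr hb]; gcongr

theorem measure_le_of_disjoint {Ω : Type*} [MeasurableSpace Ω] {μ : Measure Ω}
    {E A : Set Ω} {r b : ℝ} (hb : 0 ≤ b) (hμ : μ Eᶜ ≤ ENNReal.ofReal r)
    (hA : ∀ x ∈ E, x ∉ A) : μ A ≤ ENNReal.ofReal (r + b) :=
  (measure_mono fun x hx hE => hA x hE hx).trans
    (hμ.trans (ENNReal.ofReal_le_ofReal (by linarith)))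

theorem exists_oracleRate_eq (p : ℕ) (s : ℝ) (θ : Vec p) :
    ∃ J : Fin (p + 1), localRate p s J θ = oracleRate p s θ :=
  exists_eq_ciInf_of_finite (f := fun J : Fin (p + 1) => localRate p s J θ)

/-- `kappaBar` equals this bound plus the nonnegative term `8ν / α`. -/
theorem le_of_kappaBar_lt {α ν κ : ℝ} (hα : 0 < α) (hν : 0 < ν) (hκ : kappaBar α ν < κ) :
    5 / 2 / α + 1 / 4 ≤ κ := by
  refine le_trans ?_ hκ.le
  have e : kappaBar α ν = 8 * ν / α + (5 / 2 / α + 1 / 4) := by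
    rw [kappaBar]; field_simp; ring
  rw [e]
  exact le_add_of_nonneg_left (by positivity)

end BandedCov

/-! ### Assembly of the five bounds on the good event -/

theorem mainTheorem8
    (ε₀ ν κ δ τ₀ : ℝ) (hε₀ : 0 < ε₀) (hν : 0 < ν)
    (hκ : BandedCov.kappaBar (BandedCov.alphaC ε₀) ν < κ)
    (hδ : δ ∈ Set.Ioo (0 : ℝ) 1)
    (hτ₀ : (1 + δ) / (1 - δ) * BandedCov.tauBar (BandedCov.alphaC ε₀) κ < τ₀)
    (n p : ℕ) (hn : 1 ≤ n) (hp : 1 ≤ p)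
    (σ : ℝ) (hσ : 0 < σ) (hσ1 : σ ≤ 1)
    (Ihat : BandedCov.Vec p → Fin (p + 1)) (hI : BandedCov.IsSelector p σ κ Ihat)
    (PZ : MeasureTheory.Measure (BandedCov.Vec p))
    (hPZ : BandedCov.IsNoiseLaw p (BandedCov.alphaC ε₀) PZ)
    (k : BandedCov.Procedure) (M : ℝ) (hM : 0 ≤ M) :
    (∀ S ∈ BandedCov.covClass p ε₀,
      ∫⁻ y, BandedCov.ddm p σ κ Ihat PZ k y
          {θ | BandedCov.M₀ (BandedCov.alphaC ε₀) ν κ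
                * BandedCov.oracleRate p (σ ^ 2) (BandedCov.vec S) + M * σ ^ 2
              ≤ ‖θ - BandedCov.vec S‖ ^ 2} ∂(BandedCov.lawY n p S)
        ≤ ENNReal.ofReal (BandedCov.remainder ε₀ n p σ
            + BandedCov.H₀ ν * Real.exp (-BandedCov.m₀ (BandedCov.alphaC ε₀) ν * M))) ∧
    (∀ S ∈ BandedCov.covClass p ε₀,
      BandedCov.lawY n p S
          {y | BandedCov.M₁ (BandedCov.alphaC ε₀) ν κ
                * BandedCov.oracleRate p (σ ^ 2) (BandedCov.vec S) + M * σ ^ 2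
              ≤ ‖BandedCov.estimator p σ κ Ihat k y - BandedCov.vec S‖ ^ 2}
        ≤ ENNReal.ofReal (BandedCov.remainder ε₀ n p σ
            + BandedCov.H₁ (BandedCov.alphaC ε₀) ν κ
              * Real.exp (-BandedCov.m₁ (BandedCov.alphaC ε₀) ν * M))) ∧
    (∀ S ∈ BandedCov.covClass p ε₀,
      ∫⁻ y, ENNReal.ofReal (BandedCov.structProb p σ κ Ihat k y
          {I | BandedCov.c₃ (BandedCov.alphaC ε₀) κ
                * BandedCov.oracleRate p (σ ^ 2) (BandedCov.vec S) + M * σ ^ 2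
              ≤ BandedCov.localRate p (σ ^ 2) I (BandedCov.vec S)}) ∂(BandedCov.lawY n p S)
        ≤ ENNReal.ofReal (BandedCov.remainder ε₀ n p σ
            + BandedCov.Cnu ν * Real.exp (-BandedCov.c₂ (BandedCov.alphaC ε₀) * M))) ∧
    (∀ S ∈ BandedCov.covClass p ε₀,
      BandedCov.lawY n p S
          {y | BandedCov.M₃ (BandedCov.alphaC ε₀) κ
                * BandedCov.oracleRate p (σ ^ 2) (BandedCov.vec S) + (M + 1) * σ ^ 2
              ≤ BandedCov.rhatSq p σ Ihat y}
        ≤ ENNReal.ofReal (BandedCov.remainder ε₀ n p σ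
            + BandedCov.H₃ ν * Real.exp (-BandedCov.m₃ (BandedCov.alphaC ε₀) * M))) ∧
    (∀ t : ℝ, 0 ≤ t → ∀ S ∈ BandedCov.covClass p ε₀,
      BandedCov.vec S ∈ BandedCov.ebrClass p σ τ₀ t →
      BandedCov.lawY n p S
          {y | BandedCov.vec S ∉ Metric.closedBall (BandedCov.estimator p σ κ Ihat k y)
              (BandedCov.radius p σ Ihat (BandedCov.M₂ (BandedCov.alphaC ε₀) ν κ δ) t M y)}
        ≤ ENNReal.ofReal (BandedCov.remainder ε₀ n p σ
            + BandedCov.H₂ (BandedCov.alphaC ε₀) ν κ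
              * Real.exp (-BandedCov.m₂ (BandedCov.alphaC ε₀) ν κ δ τ₀ * M))) := by
  
  have hα := BandedCov.alphaC_pos hε₀
  have hα1 := BandedCov.alphaC_le_one ε₀
  set α := BandedCov.alphaC ε₀
  have hκ' := BandedCov.le_of_kappaBar_lt hα hν hκ
  have hκ0 : 0 < κ := lt_of_lt_of_le (by positivity) hκ'
  have hPr := hPZ.isProb
  have hC := BandedCov.one_le_Cnu hν
  have hrem : 0 ≤ BandedCov.remainder ε₀ n p σ := by unfold BandedCov.remainder; positivity
  have hH₀ : 0 ≤ BandedCov.H₀ ν := by unfold BandedCov.H₀; linarith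
  have hH₁ : 0 ≤ BandedCov.H₁ α ν κ := (Real.exp_pos _).le.trans (le_max_right _ _)
  have hH₂ : 0 ≤ BandedCov.H₂ α ν κ := by unfold BandedCov.H₂; linarith
  have hH₃ : 0 ≤ BandedCov.H₃ ν := by unfold BandedCov.H₃; linarith
  have hE (S : Matrix (Fin p) (Fin p) ℝ) :=
    BandedCov.measurableSet_goodSet p (σ * √(1 / (4 * α))) (BandedCov.vec S)
  have hμ (S : Matrix (Fin p) (Fin p) ℝ) (hS : S ∈ BandedCov.covClass p ε₀) :=
    BandedCov.lawY_goodSet_compl_le_remainder (n := n) hn hp hε₀ hσ hσ1 hS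
  have hN {y θ : BandedCov.Vec p} (hy : y ∈ BandedCov.goodSet p (σ * √(1 / (4 * α))) θ) (I : ℕ)
      (hI : I ≤ p) := BandedCov.norm_proj_noise_le hI hα hy
  refine ⟨fun S hS => ?_, fun S hS => ?_, fun S hS => ?_, fun S hS => ?_, fun t ht S hS hθ => ?_⟩
  · obtain ⟨J, hJ⟩ := BandedCov.exists_oracleRate_eq p (σ ^ 2) (BandedCov.vec S)
    rw [← hJ]
    exact BandedCov.lintegral_le_of_le_on (hE S) hrem (mul_nonneg hH₀ (Real.exp_pos _).le)
      (hμ S hS)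
      (fun y => BandedCov.ddm_apply_le_one k y (measurableSet_le (by fun_prop) (by fun_prop)))
      fun y hy => BandedCov.ddm_tail_le hPZ hp hσ hα hα1 hν hκ' hM hI (hN hy) k J
  · obtain ⟨J, hJ⟩ := BandedCov.exists_oracleRate_eq p (σ ^ 2) (BandedCov.vec S)
    rw [← hJ]
    refine BandedCov.measure_le_of_disjoint (mul_nonneg hH₁ (Real.exp_pos _).le) (hμ S hS)
      fun y hy hA => ?_
    have h := BandedCov.norm_estimator_sub_sq_lt hp hσ hα hα1 hν hκ' hI (hN hy) k J
    have h0 : 0 ≤ M * σ ^ 2 := by positivity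
    exact absurd (Set.mem_ofPred_eq ▸ hA) (not_le.2 (by linarith))
  · obtain ⟨J, hJ⟩ := BandedCov.exists_oracleRate_eq p (σ ^ 2) (BandedCov.vec S)
    rw [← hJ]
    refine BandedCov.lintegral_le_of_le_on (hE S) hrem (by positivity) (hμ S hS)
      (fun y => ?_) fun y hy => ENNReal.ofReal_le_ofReal ?_
    · exact ENNReal.ofReal_le_one.2 (BandedCov.structProb_le_one k y _)
    · exact (BandedCov.structProb_le_exp hp hσ hα hα1 hκ' hM hI (hN hy) k J).trans
        (le_mul_of_one_le_left (Real.exp_pos _).le hC)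
  · obtain ⟨J, hJ⟩ := BandedCov.exists_oracleRate_eq p (σ ^ 2) (BandedCov.vec S)
    rw [← hJ]
    refine BandedCov.measure_le_of_disjoint (mul_nonneg hH₃ (Real.exp_pos _).le) (hμ S hS)
      fun y hy hA => ?_
    -- The additional `σ²` in the threshold matches the first summand of `r̂²`, and the dimension
    -- part of `r̂²` is dominated by the local rate.
    have h := BandedCov.localRate_Ihat_lt hp hσ hα hα1 hκ' hM hI (hN hy) J
    have h2 : σ ^ 2 * BandedCov.rho p (Ihat y) ≤
        BandedCov.localRate p (σ ^ 2) (Ihat y) (BandedCov.vec S) :=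
      le_add_of_nonneg_left (sq_nonneg _)
    simp only [Set.mem_ofPred_eq, BandedCov.rhatSq, BandedCov.M₃] at hA
    linarith
  · obtain ⟨I, horacle, hebr⟩ := hθ
    refine BandedCov.measure_le_of_disjoint (mul_nonneg hH₂ (Real.exp_pos _).le) (hμ S hS)
      fun y hy hA => hA ?_
    -- The reference here is the `τ₀`-oracle `I` from the class, not a minimiser of the local rate.
    have h1 := BandedCov.norm_estimator_sub_sq_lt hp hσ hα hα1 hν hκ' hI (hN hy) k I
    have h2 := BandedCov.M₁_mul_oracle_le_radius_sq hp hσ hα hν hκ0 hδ hτ₀ ht hM hI (hN hy)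
      horacle hebr
    rw [Metric.mem_closedBall, dist_comm, dist_eq_norm]
    exact Real.le_sqrt_of_sq_le (h1.le.trans h2)
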